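/- **Setting.** Let $F$ be a totally real number field of degree $d$ with ring of integers $\mathfrak r$ and ring of finite adeles $\widehat F$, let $\mathfrak n\neq 0$ be an ideal of $\mathfrak r$, and let $p$ be an odd prime that is unramified in $F$ and prime to $\mathfrak n$; put $\mathfrak r_p=\mathfrak r\otimes\mathbb Z_p=\prod_{\mathfrak p\mid p}\mathfrak r_{\mathfrak p}$. For an ideal $\mathfrak m$ let $\Delta_0(\mathfrak m)$ be the semigroup of the matrices $\begin{pmatrix}a&b\\c&d\end{pmatrix}\in \mathrm{GL}_2(\widehat F)\cap \mathrm M_2(\widehat{\mathfrak r})$ with $c\equiv 0 \bmod \mathfrak m$, let $U_0(\mathfrak m)=\Delta_0(\mathfrak m)\cap\mathrm{GL}_2(\widehat{\mathfrak r})$, and let $U_1(\mathfrak m)$ (resp. $U(\mathfrak m)$) be the subgroup of $U_0(\mathfrak m)$ given by $a\equiv1$ (resp. $a\equiv d\equiv 1$) modulo $\mathfrak m$. Let $S$ be an open compact subgroup of $\mathrm{GL}_2(\widehat F)$ with $U_1(\mathfrak n)\subseteq S\subseteq U_0(\mathfrak n)$ such that for all $g\in \mathrm{GL}_2(\widehat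 F)$ the group $\Gamma/(\Gamma\cap F^\times)$, with $\Gamma=gSg^{-1}\cap \mathrm{GL}_2^+(F)$, is torsion-free. For an open subgroup $U$ of $S$ let $X_U=\mathrm{GL}_2(F)\backslash \mathrm{GL}_2(F_{\mathbb A})/U\,(\mathrm{SO}_2(\mathbb R)\mathbb R_+)^d$. A module $E$ on which $U$ operates on the right (the elements of $U\cap F^\times$ trivially) defines a local system $\mathcal E$ on $X_U$, whose singular $k$-cochains are the functions $c(g,\tau)\in E$ of $g\in\mathrm{GL}_2(\widehat F)$ and singular $k$-simplices $\tau$ of $\mathrm{GL}_2(\mathbb R)^d/(\mathrm{SO}_2(\mathbb R)\mathbb R_+)^d$ with $c(\gamma g,\gamma\tau)=c(g,\tau)$ for $\gamma\in\mathrm{GL}_2(F)$ and $c(gu,\tau)=c(g,\tau)|u$ for $u\in U$; $H^k_{\rm cpt}(X_U,\mathcal E)$ is its cohomology with compact support. If moreover the elements $s\in UxU$ operate on $E$ compatibly with $U$, the Hecke operator $T(x)$ is induced by $(c|T(x))(g,\tau)=\sum_{Us\subseteq UxU}c(gs^{-1},\tau)|s$. For a prime $\mathfrak q$ put $T(\mathfrak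 q)=T\begin{pmatrix}1&0\\0&q\end{pmatrix}$, where $q$ is an idele that generates $\mathfrak q$ at $\mathfrak q$ and is $1$ at the other primes; put $T(p)=T\begin{pmatrix}1&0\\0&\varpi\end{pmatrix}$, where $\varpi$ is the idele that is $p$ at the primes $\mathfrak p\mid p$ and $1$ at the other primes. *$\Lambda$-adic symbols.* Let $K$ be a finite extension of $\mathbb Q_p$ that receives all the $d$ embeddings of $F$, with ring of integers $\mathcal O$, and let $I$ be the set of embeddings $\sigma:F\to K$. Let $\bar{\mathfrak e}$ be the closure of $S\cap F^\times$ in $\mathfrak r_p^\times$ and $X=\bar{\mathfrak e}\backslash\big((\mathfrak r_p^2)'\times\mathfrak r_p^\times\big)$, where $(\mathfrak r_p^2)'=\prod_{\mathfrak p\mid p}(\mathfrak r_{\mathfrak p}^2)'$ is the set of the vectors that are primitive at each $\mathfrak p\mid p$, and $e\cdot((x,y),z)=((ex,ey),e^2z)$. For $s\in \mathrm{GL}_2(\widehat F)\cap \mathrm M_2(\widehat{\mathfrak r})$ put $((x,y),z)*s=((x,y)s_p,\ z\cdot\delta(s))$, where $\delta(s)\in\mathfrak r_p^\times$ has the component $p^{-c(\mathfrak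 p)}\det s_{\mathfrak p}$ at $\mathfrak p$, with $c(\mathfrak p)$ the valuation of $\det s_{\mathfrak p}$. Let $\mathbb D_X$ be the $\mathcal O$-module of $\mathcal O$-valued measures on $X$, let $\int_X\varphi\,d(\mu*s)$ be the integral of $\varphi(\eta*s)$ with respect to $\mu$ over the $\eta\in X$ with $\eta*s\in X$, and let $\mathbb W=H^d_{\rm cpt}(X_S,\mathcal D_X)$. *Classical symbols.* Let $n\in\mathbb Z_{\ge0}[I]$ and $v\in\mathbb Z[I]$ with $n_\sigma+2v_\sigma=m$ for all $\sigma$, let $\alpha\ge1$, and let $\epsilon:(\mathfrak r_p/p^\alpha)^\times\to\mathcal O^\times$ be a character with $\epsilon(e)\prod_\sigma\sigma(e)^m=1$ for $e\in\bar{\mathfrak e}$; write $\kappa$ for these data. Let $L(n,v,\epsilon,\mathcal O)$ be the module of the polynomials over $\mathcal O$ in the variables $X_\sigma,Y_\sigma$ ($\sigma\in I$), homogeneous of degree $n_\sigma$ in $X_\sigma,Y_\sigma$, with $(P|_\epsilon s)(X,Y)=\epsilon(a)\det(s_p)^vP\big((X,Y)s_p^*\big)$ for $s\in\Delta_0(p^\alpha)$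 with $s_p=\begin{pmatrix}a&b\\c&d\end{pmatrix}$ and $s_p^*=\begin{pmatrix}d&-b\\-c&a\end{pmatrix}$, where $z^v=\prod_\sigma\sigma(z)^{v_\sigma}$ and $\epsilon(a)=0$ if $a$ is not a unit. Let $U$ be an open subgroup with $S\cap U(p^\alpha)\subseteq U\subseteq S\cap U_0(p^\alpha)$, and let $\mathbb W_\kappa=H^d_{\rm cpt}(X_U,\mathcal L(n,v,\epsilon,\mathcal O))$. On $\mathbb W_\kappa$ there is the normalized operator $T_0(p)=(\{p\}^v)^{-1}T(p)$, with $\{p\}^v=\prod_\sigma p^{v_\sigma}$, in which $s$ operates on the coefficients by $P\mapsto(\{p\}^v)^{-1}P|_\epsilon s$ (this preserves $L(n,v,\epsilon,\mathcal O)$). Let $\rho_\kappa:\mathbb W\to\mathbb W_\kappa$ be the map induced by the projection $X_U\to X_S$ and by the $U$-equivariant map $$\rho_\kappa:\mathbb D_X\to L(n,v,\epsilon,\mathcal O),\qquad \rho_\kappa(\mu)=\int_{X'}z^v\epsilon(x)(xY-yX)^n\,d\mu(x,y,z),$$ where $X'=\{((x,y),z)\in X: x\in\mathfrak r_p^\times\}$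 and $(xY-yX)^n=\prod_\sigma(\sigma(x)Y_\sigma-\sigma(y)X_\sigma)^{n_\sigma}$. **Proposition.** Let $\Phi\in\mathbb W$. Then 1. $\rho_\kappa(\Phi*T(\mathfrak q))=\rho_\kappa(\Phi)|T(\mathfrak q)$ for every prime ideal $\mathfrak q$ of $\mathfrak r$ that does not divide $p$; 2. $\rho_\kappa(\Phi*T(p))=\rho_\kappa(\Phi)|T_0(p)$. -/

import Mathlib

open IsDedekindDomain HeightOneSpectrum NumberField MvPolynomial
open scoped Matrix

noncomputable section

namespace HilbertSymbols

section Local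

variable (F : Type*) [Field F] [NumberField F] (p : ℕ)

/-- The primes of `F` above `p`. -/
abbrev PlaceAbove : Type _ := {w : HeightOneSpectrum (𝓞 F) // (p : 𝓞 F) ∈ w.asIdeal}

/-- `𝔯_p = 𝔯 ⊗ ℤ_p`, as the product of the completions `𝔯_𝔭` over the primes `𝔭 ∣ p`. -/
abbrev Rp : Type _ := (w : PlaceAbove F p) → w.1.adicCompletionIntegers F

/-- `GL₂` of the ring of finite adeles of `F`. -/
abbrev GLf : Type _ := GL (Fin 2) (FiniteAdeleRing (𝓞 F) F)

variable {F}

/-- The component at `w` of a finite adele, as a ring homomorphism. -/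
def evalAt (w : HeightOneSpectrum (𝓞 F)) : FiniteAdeleRing (𝓞 F) F →+* w.adicCompletion F where
  toFun a := a w
  map_one' := rfl
  map_mul' _ _ := rfl
  map_zero' := rfl
  map_add' _ _ := rfl

/-- The component at `w` of an element of `GL₂` of the finite adeles. -/
def compAt (w : HeightOneSpectrum (𝓞 F)) : GLf F →* GL (Fin 2) (w.adicCompletion F) :=
  Matrix.GeneralLinearGroup.map (evalAt w)

/-- The inclusion `𝔯_w ⊆ F_w`. -/
abbrev inclAt (w : HeightOneSpectrum (𝓞 F)) : w.adicCompletionIntegers F →+* w.adicCompletion F :=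
  (w.adicCompletionIntegers F).subtype

/-- The ideal `𝔪 𝔯_w` of `𝔯_w`. -/
def idealAt (𝔪 : Ideal (𝓞 F)) (w : HeightOneSpectrum (𝓞 F)) : Ideal (w.adicCompletionIntegers F) :=
  𝔪.map (algebraMap (𝓞 F) (w.adicCompletionIntegers F))

lemma GL_inv_apply {R : Type*} [CommRing R] (k : GL (Fin 2) R) :
    ((k⁻¹ : GL (Fin 2) R) : Matrix (Fin 2) (Fin 2) R) =
      ((k.det⁻¹ : Rˣ) : R) • (k : Matrix (Fin 2) (Fin 2) R).adjugate := by
  rw [Matrix.coe_units_inv, Matrix.inv_def]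
  congr 1
  rw [← Matrix.GeneralLinearGroup.val_det_apply, Ring.inverse_unit]

lemma GL_det_inv_mul {R : Type*} [CommRing R] (k : GL (Fin 2) R) :
    ((k.det⁻¹ : Rˣ) : R) * (k 0 0 * k 1 1 - k 0 1 * k 1 0) = 1 := by
  rw [← Matrix.det_fin_two, ← Matrix.GeneralLinearGroup.val_det_apply, Units.inv_mul]

/-- Matrices in `GL₂(R)` with `c ∈ J`. -/
def localGamma0 {R : Type*} [CommRing R] (J : Ideal R) : Subgroup (GL (Fin 2) R) where
  carrier := {k | k 1 0 ∈ J}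
  one_mem' := by simp
  mul_mem' := by
    intro k l hk hl
    simp only [Set.mem_ofPred_eq, Units.val_mul, Matrix.mul_apply, Fin.sum_univ_two] at *
    exact J.add_mem (J.mul_mem_right _ hk) (J.mul_mem_left _ hl)
  inv_mem' := by
    intro k hk
    simp only [Set.mem_ofPred_eq, GL_inv_apply, Matrix.adjugate_fin_two, Matrix.smul_apply,
      Matrix.of_apply, Matrix.cons_val', Matrix.cons_val_zero, Matrix.cons_val_one,
      smul_eq_mul] at *
    exact J.mul_mem_left _ (J.neg_mem hk)

/-- Matrices in `GL₂(R)` with `c ∈ J` and `a - 1 ∈ J`. -/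
def localGamma1 {R : Type*} [CommRing R] (J : Ideal R) : Subgroup (GL (Fin 2) R) where
  carrier := {k | k 1 0 ∈ J ∧ k 0 0 - 1 ∈ J}
  one_mem' := by simp
  mul_mem' := by
    rintro k l ⟨hk, hk'⟩ ⟨hl, hl'⟩
    refine ⟨(localGamma0 J).mul_mem hk hl, ?_⟩
    simp only [Units.val_mul, Matrix.mul_apply, Fin.sum_univ_two]
    have : k 0 0 * l 0 0 + k 0 1 * l 1 0 - 1 =
      (k 0 0 - 1) * l 0 0 + (l 0 0 - 1) + k 0 1 * l 1 0 := by ring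
    rw [this]
    exact J.add_mem (J.add_mem (J.mul_mem_right _ hk') hl') (J.mul_mem_left _ hl)
  inv_mem' := by
    rintro k ⟨hk, hk'⟩
    refine ⟨(localGamma0 J).inv_mem hk, ?_⟩
    simp only [GL_inv_apply, Matrix.adjugate_fin_two, Matrix.smul_apply,
      Matrix.of_apply, Matrix.cons_val', Matrix.cons_val_zero, smul_eq_mul]
    have h1 := GL_det_inv_mul k
    have : ((k.det⁻¹ : Rˣ) : R) * k 1 1 - 1 =
      -(((k.det⁻¹ : Rˣ) : R) * k 1 1) * (k 0 0 - 1) + (((k.det⁻¹ : Rˣ) : R) * k 0 1) * k 1 0 := by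
      linear_combination h1
    rw [this]
    exact J.add_mem (J.mul_mem_left _ hk') (J.mul_mem_left _ hk)

/-- Matrices in `GL₂(R)` with `c ∈ J`, `a - 1 ∈ J` and `d - 1 ∈ J`. -/
def localGamma {R : Type*} [CommRing R] (J : Ideal R) : Subgroup (GL (Fin 2) R) where
  carrier := {k | k ∈ localGamma1 J ∧ k 1 1 - 1 ∈ J}
  one_mem' := ⟨(localGamma1 J).one_mem, by simp⟩
  mul_mem' := by
    rintro k l ⟨hk, hk'⟩ ⟨hl, hl'⟩
    refine ⟨(localGamma1 J).mul_mem hk hl, ?_⟩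
    simp only [Units.val_mul, Matrix.mul_apply, Fin.sum_univ_two]
    have : k 1 0 * l 0 1 + k 1 1 * l 1 1 - 1 =
      k 1 0 * l 0 1 + (k 1 1 - 1) * l 1 1 + (l 1 1 - 1) := by ring
    rw [this]
    exact J.add_mem (J.add_mem (J.mul_mem_right _ hk.1) (J.mul_mem_right _ hk')) hl'
  inv_mem' := by
    rintro k ⟨hk, hk'⟩
    refine ⟨(localGamma1 J).inv_mem hk, ?_⟩
    simp only [GL_inv_apply, Matrix.adjugate_fin_two, Matrix.smul_apply,
      Matrix.of_apply, Matrix.cons_val', Matrix.cons_val_one, smul_eq_mul]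
    change ((k.det⁻¹ : Rˣ) : R) * k 0 0 - 1 ∈ J
    have h1 := GL_det_inv_mul k
    have : ((k.det⁻¹ : Rˣ) : R) * k 0 0 - 1 =
      -(((k.det⁻¹ : Rˣ) : R) * k 0 0) * (k 1 1 - 1) + (((k.det⁻¹ : Rˣ) : R) * k 0 1) * k 1 0 := by
      linear_combination h1
    rw [this]
    exact J.add_mem (J.mul_mem_left _ hk') (J.mul_mem_left _ hk.1)

/-- The elements of `GL₂(F̂)` all of whose components lie in the local subgroups `H w`
of `GL₂(𝔯_w)`. -/
def globalize (H : ∀ w : HeightOneSpectrum (𝓞 F), Subgroup (GL (Fin 2) (w.adicCompletionIntegers F))) :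
    Subgroup (GLf F) :=
  ⨅ w, ((H w).map (Matrix.GeneralLinearGroup.map (inclAt w))).comap (compAt w)

/-- `U₀(𝔪)`. -/
def U0 (𝔪 : Ideal (𝓞 F)) : Subgroup (GLf F) := globalize fun w => localGamma0 (idealAt 𝔪 w)

/-- `U₁(𝔪)`. -/
def U1 (𝔪 : Ideal (𝓞 F)) : Subgroup (GLf F) := globalize fun w => localGamma1 (idealAt 𝔪 w)

/-- `U(𝔪)`. -/
def Ufull (𝔪 : Ideal (𝓞 F)) : Subgroup (GLf F) := globalize fun w => localGamma (idealAt 𝔪 w)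

/-- The semigroup `Δ₀(𝔪)` of integral matrices in `GL₂(F̂)` with `c ≡ 0 mod 𝔪`. -/
def Delta0 (𝔪 : Ideal (𝓞 F)) : Submonoid (GLf F) where
  carrier := {s | ∀ w : HeightOneSpectrum (𝓞 F),
    ∃ M : Matrix (Fin 2) (Fin 2) (w.adicCompletionIntegers F),
      (inclAt w).mapMatrix M = (compAt w s : Matrix (Fin 2) (Fin 2) (w.adicCompletion F)) ∧
        M 1 0 ∈ idealAt 𝔪 w}
  one_mem' := fun w => ⟨1, by simp, by simp⟩
  mul_mem' := by
    intro s t hs ht w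
    obtain ⟨M, hM, hM'⟩ := hs w
    obtain ⟨N, hN, hN'⟩ := ht w
    refine ⟨M * N, by rw [map_mul, hM, hN, map_mul, Units.val_mul], ?_⟩
    rw [Matrix.mul_apply, Fin.sum_univ_two]
    exact Ideal.add_mem _ (Ideal.mul_mem_right _ _ hM') (Ideal.mul_mem_left _ _ hN')

lemma U0_le_Delta0 (𝔪 : Ideal (𝓞 F)) : ∀ u ∈ U0 𝔪, u ∈ Delta0 𝔪 := by
  intro u hu w
  simp only [U0, globalize, Subgroup.mem_iInf, Subgroup.mem_comap, Subgroup.mem_map] at hu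
  obtain ⟨k, hk, hk'⟩ := hu w
  exact ⟨k, by rw [← hk']; rfl, hk⟩

lemma Delta0_mono {𝔪 𝔪' : Ideal (𝓞 F)} (h : 𝔪 ≤ 𝔪') : Delta0 𝔪 ≤ Delta0 𝔪' := by
  intro s hs w
  obtain ⟨M, hM, hM'⟩ := hs w
  exact ⟨M, hM, Ideal.map_mono h hM'⟩

lemma U0_mono {𝔪 𝔪' : Ideal (𝓞 F)} (h : 𝔪 ≤ 𝔪') : U0 𝔪 ≤ U0 𝔪' := by
  intro u hu
  simp only [U0, globalize, Subgroup.mem_iInf, Subgroup.mem_comap, Subgroup.mem_map] at hu ⊢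
  intro w
  obtain ⟨k, hk, hk'⟩ := hu w
  exact ⟨k, Ideal.map_mono h hk, hk'⟩

/-- An integral element of `F_w`, as an element of `𝔯_w`; the value `0` at non-integral elements
is never used. -/
def toInt (w : HeightOneSpectrum (𝓞 F)) (x : w.adicCompletion F) : w.adicCompletionIntegers F :=
  open Classical in if h : x ∈ w.adicCompletionIntegers F then ⟨x, h⟩ else 0

@[simp] lemma toInt_coe (w : HeightOneSpectrum (𝓞 F)) (x : w.adicCompletionIntegers F) :
    toInt w (x : w.adicCompletion F) = x := by
  simp [toInt]

lemma toInt_mul_unit (w : HeightOneSpectrum (𝓞 F)) (x : w.adicCompletion F)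
    (u : (w.adicCompletionIntegers F)ˣ) :
    toInt w (x * ((u : w.adicCompletionIntegers F) : w.adicCompletion F)) = toInt w x * u := by
  by_cases h : x ∈ w.adicCompletionIntegers F
  · lift x to w.adicCompletionIntegers F using h
    rw [← MulMemClass.coe_mul, toInt_coe, toInt_coe]
  · have h' : x * ((u : w.adicCompletionIntegers F) : w.adicCompletion F) ∉
        w.adicCompletionIntegers F := by
      intro h2
      apply h
      have := mul_mem h2 (((u⁻¹ : (w.adicCompletionIntegers F)ˣ) :
        w.adicCompletionIntegers F)).2
      rwa [mul_assoc, ← MulMemClass.coe_mul, Units.mul_inv, OneMemClass.coe_one, mul_one] at this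
    simp [toInt, h, h']

/-- The `p`-component of an element of `GL₂(F̂)` that is integral at `p`, as a matrix
over `𝔯_p`. -/
def pMat (s : GLf F) : Matrix (Fin 2) (Fin 2) (Rp F p) :=
  Matrix.of fun i j w => toInt w.1 (s i j w.1)

lemma pMat_coe {s : GLf F} (hs : s ∈ Delta0 (⊤ : Ideal (𝓞 F))) (i j : Fin 2) (w : PlaceAbove F p) :
    ((pMat p s i j w : w.1.adicCompletionIntegers F) : w.1.adicCompletion F) = s i j w.1 := by
  obtain ⟨M, hM, -⟩ := hs w.1
  have : ((M i j : w.1.adicCompletionIntegers F) : w.1.adicCompletion F) = s i j w.1 :=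
    congrFun (congrFun hM i) j
  simp only [pMat, Matrix.of_apply]
  rw [← this, toInt_coe]

lemma pMat_mul {s t : GLf F} (hs : s ∈ Delta0 (⊤ : Ideal (𝓞 F)))
    (ht : t ∈ Delta0 (⊤ : Ideal (𝓞 F))) : pMat p (s * t) = pMat p s * pMat p t := by
  ext i j w
  rw [pMat_coe p (mul_mem hs ht)]
  simp only [Matrix.mul_apply, Fin.sum_univ_two, Units.val_mul, Pi.add_apply, Pi.mul_apply,
    AddMemClass.coe_add, MulMemClass.coe_mul]
  rw [pMat_coe p hs, pMat_coe p hs, pMat_coe p ht, pMat_coe p ht]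
  rfl

@[simp] lemma pMat_one : pMat p (1 : GLf F) = 1 := by
  ext i j w
  rw [pMat_coe p (one_mem _)]
  fin_cases i <;> fin_cases j <;> rfl

lemma isUnit_det_pMat {u : GLf F} (hu : u ∈ U0 (⊤ : Ideal (𝓞 F))) : IsUnit (pMat p u).det := by
  have h : pMat p u * pMat p u⁻¹ = 1 := by
    rw [← pMat_mul p (U0_le_Delta0 _ u hu) (U0_le_Delta0 _ _ (inv_mem hu)), mul_inv_cancel,
      pMat_one]
  exact IsUnit.of_mul_eq_one _ (by rw [← Matrix.det_mul, h, Matrix.det_one])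

end Local

section Embeddings

variable (K : Type*) [NormedField K] [IsUltrametricDist K]

/-- The ring of integers `𝒪 = {x : ‖x‖ ≤ 1}` of `K`. -/
def OK : Subring K where
  carrier := {x | ‖x‖ ≤ 1}
  one_mem' := by simp
  mul_mem' := by
    intro a b ha hb
    simp only [Set.mem_ofPred_eq, norm_mul] at *
    exact mul_le_one₀ ha (norm_nonneg _) hb
  zero_mem' := by simp
  add_mem' := by
    intro a b ha hb
    exact (IsUltrametricDist.norm_add_le_max a b).trans (max_le ha hb)
  neg_mem' := by
    intro a ha
    simpa using ha

variable {K}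

/-- An element of norm at most `1`, as an element of `𝒪`; the value `0` at the other elements
is never used. -/
def toO (x : K) : OK K := open Classical in if h : ‖x‖ ≤ 1 then ⟨x, h⟩ else 0

@[simp] lemma toO_coe (x : OK K) : toO (x : K) = x := by
  have : ‖(x : K)‖ ≤ 1 := x.2
  simp [toO, this]

lemma coe_toO {x : K} (h : ‖x‖ ≤ 1) : ((toO x : OK K) : K) = x := by
  simp [toO, h]

lemma toO_mul_of_norm_eq_one (x y : K) (hy : ‖y‖ = 1) : toO (x * y) = toO x * toO y := by
  by_cases h : ‖x‖ ≤ 1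
  · apply Subtype.ext
    rw [Subring.coe_mul, coe_toO h, coe_toO hy.le, coe_toO (by rw [norm_mul, hy, mul_one]; exact h)]
  · have h' : ¬ ‖x * y‖ ≤ 1 := by rwa [norm_mul, hy, mul_one]
    simp only [toO, h, h', dif_neg, not_false_eq_true, zero_mul]

lemma norm_embedding_le_one {F : Type*} [Field F] (σ : F →+* K) (a : 𝓞 F) : ‖σ a‖ ≤ 1 := by
  have h1 : IsIntegral ℤ (σ (a : F)) := (map_isIntegral_int σ a.isIntegral_coe)
  have h2 : IsIntegral (NormedField.valuation (K := K)).integer (σ (a : F)) := h1.tower_top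
  have h3 := (Valuation.integer.integers (NormedField.valuation (K := K))).mem_of_integral h2
  exact h3

lemma norm_prime_lt_one {K : Type*} [NormedField K] (p : ℕ) [Fact p.Prime]
    [NormedAlgebra ℚ_[p] K] : ‖(p : K)‖ < 1 := by
  rw [← map_natCast (algebraMap ℚ_[p] K) p, norm_algebraMap']
  exact Padic.norm_p_lt_one

lemma natCast_prime_ne_zero {K : Type*} [NormedField K] (p : ℕ) [Fact p.Prime]
    [NormedAlgebra ℚ_[p] K] : (p : K) ≠ 0 := by
  rw [← map_natCast (algebraMap ℚ_[p] K) p, Ne, map_eq_zero]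
  exact_mod_cast (Fact.out : p.Prime).ne_zero

/-- The prime of `F` above `p` induced by an embedding `σ` of `F` into the `p`-adic field `K`. -/
def placeOf {F : Type*} [Field F] [NumberField F] (p : ℕ) [Fact p.Prime] [NormedAlgebra ℚ_[p] K]
    (σ : F →+* K) : PlaceAbove F p :=
  ⟨{ asIdeal :=
      { carrier := {a | ‖σ a‖ < 1}
        add_mem' := by
          intro a b ha hb
          simp only [Set.mem_ofPred_eq, map_add] at *
          exact (IsUltrametricDist.norm_add_le_max _ _).trans_lt (max_lt ha hb)
        zero_mem' := by simp
        smul_mem' := by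
          intro a b hb
          simp only [Set.mem_ofPred_eq, smul_eq_mul, map_mul, norm_mul] at *
          exact mul_lt_one_of_nonneg_of_lt_one_right (norm_embedding_le_one σ a)
            (norm_nonneg _) hb }
     isPrime := by
      constructor
      · rw [Ne, Ideal.eq_top_iff_one]
        change ¬ ‖σ ((1 : 𝓞 F) : F)‖ < 1
        simp
      · intro a b hab
        change ‖σ ((a * b : 𝓞 F) : F)‖ < 1 at hab
        change ‖σ (a : F)‖ < 1 ∨ ‖σ (b : F)‖ < 1
        by_contra! h
        rw [show ((a * b : 𝓞 F) : F) = (a : F) * (b : F) from rfl, map_mul, norm_mul] at hab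
        exact absurd hab (not_lt.2 (one_le_mul_of_one_le_of_one_le h.1 h.2))
     ne_bot := by
      intro h
      have h1 : (p : 𝓞 F) ∈ (⊥ : Ideal (𝓞 F)) := by
        rw [← h]
        change ‖σ ((p : 𝓞 F) : F)‖ < 1
        simpa using norm_prime_lt_one (K := K) p
      rw [Ideal.mem_bot] at h1
      exact (Fact.out : p.Prime).ne_zero (by exact_mod_cast h1) }, by
    change ‖σ ((p : 𝓞 F) : F)‖ < 1
    simpa using norm_prime_lt_one (K := K) p⟩

section

variable {F : Type*} [Field F] [NumberField F] (p : ℕ) [Fact p.Prime] [NormedAlgebra ℚ_[p] K]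
  (σ : F →+* K)

lemma norm_le_one_of_valuation_le_one {x : F} (hx : (placeOf p σ).1.valuation F x ≤ 1) :
    ‖σ x‖ ≤ 1 := by
  obtain ⟨a, b, hab⟩ := exists_primeCompl_mul_eq_of_integer (placeOf p σ).1 x hx
  have hb : ‖σ ((b : 𝓞 F) : F)‖ = 1 := by
    refine le_antisymm (norm_embedding_le_one σ _) (not_lt.1 ?_)
    exact b.2
  have h := congrArg (fun y => ‖σ y‖) hab
  simp only [map_mul, norm_mul] at h
  have h1 : ‖σ x‖ * 1 = ‖σ (a : F)‖ := by rw [← hb]; exact h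
  rw [← mul_one ‖σ x‖, h1]
  exact norm_embedding_le_one σ a

/-- `σ`, seen as a homomorphism from `F` with its `𝔭_σ`-adic topology. -/
def embWithVal : WithVal ((placeOf p σ).1.valuation F) →+* K :=
  σ.comp (WithVal.equiv ((placeOf p σ).1.valuation F)).toRingHom

lemma continuous_embWithVal : Continuous (embWithVal p σ) := by
  refine continuous_of_continuousAt_zero (embWithVal p σ).toAddMonoidHom ?_
  rw [ContinuousAt, Metric.tendsto_nhds]
  intro ε hε
  obtain ⟨k, hk⟩ := exists_pow_lt_of_lt_one hε (norm_prime_lt_one (K := K) p)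
  have hp0 : (p : F) ≠ 0 := by exact_mod_cast (Fact.out : p.Prime).ne_zero
  have hv0 : Valued.v.restrict (WithVal.toVal ((placeOf p σ).1.valuation F) ((p : F) ^ k)) ≠ 0 := by
    simp [(Fact.out : p.Prime).ne_zero]
  refine Filter.mem_of_superset (Valued.mem_nhds_zero.2 ⟨Units.mk0 _ hv0, subset_rfl⟩) ?_
  intro x hx
  simp only [Set.mem_ofPred_eq, Units.val_mk0, Valuation.restrict_lt_iff] at hx
  change (placeOf p σ).1.valuation F x.ofVal < (placeOf p σ).1.valuation F ((p : F) ^ k) at hx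
  change dist (σ x.ofVal) (σ 0) < ε
  rw [map_zero, dist_zero_right]
  have hy : ‖σ (x.ofVal / (p : F) ^ k)‖ ≤ 1 := by
    apply norm_le_one_of_valuation_le_one p σ
    rw [map_div₀]
    exact div_le_one_of_le₀ hx.le zero_le
  have hxy : x.ofVal = (p : F) ^ k * (x.ofVal / (p : F) ^ k) := by
    field_simp
  rw [hxy, map_mul, map_pow, map_natCast, norm_mul, norm_pow]
  exact (mul_le_of_le_one_right (by positivity) hy).trans_lt hk

variable [FiniteDimensional ℚ_[p] K]

/-- The continuous extension `F_{𝔭_σ} → K` of the embedding `σ : F → K`. -/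
def localEmb : (placeOf p σ).1.adicCompletion F →+* K :=
  haveI : CompleteSpace K := FiniteDimensional.complete ℚ_[p] K
  (IsDenseInducing.extendRingHom
    (i := UniformSpace.Completion.coeRingHom (α := WithVal ((placeOf p σ).1.valuation F)))
    (f := embWithVal p σ)
    (UniformSpace.Completion.isUniformInducing_coe _)
    UniformSpace.Completion.denseRange_coe
    (uniformContinuous_addMonoidHom_of_continuous (f := (embWithVal p σ).toAddMonoidHom)
      (continuous_embWithVal p σ))).comp
  (adicCompletion.equiv F (placeOf p σ).1).toRingHom

lemma continuous_localEmb : Continuous (localEmb p σ) := by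
  have : CompleteSpace K := FiniteDimensional.complete ℚ_[p] K
  have h := uniformContinuous_uniformly_extend
    (e := UniformSpace.Completion.coeRingHom (α := WithVal ((placeOf p σ).1.valuation F)))
    (UniformSpace.Completion.isUniformInducing_coe _) UniformSpace.Completion.denseRange_coe
    (uniformContinuous_addMonoidHom_of_continuous (f := (embWithVal p σ).toAddMonoidHom)
      (continuous_embWithVal p σ))
  exact h.continuous.comp (adicCompletion.continuous_toCompletion F (placeOf p σ).1)

lemma localEmb_coe (a : F) :
    localEmb p σ (algebraMap F ((placeOf p σ).1.adicCompletion F) a) = σ a := by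
  have : CompleteSpace K := FiniteDimensional.complete ℚ_[p] K
  exact uniformly_extend_of_ind
    (e := UniformSpace.Completion.coeRingHom (α := WithVal ((placeOf p σ).1.valuation F)))
    (UniformSpace.Completion.isUniformInducing_coe _) UniformSpace.Completion.denseRange_coe
    (uniformContinuous_addMonoidHom_of_continuous (f := (embWithVal p σ).toAddMonoidHom)
      (continuous_embWithVal p σ)) (WithVal.toVal _ a)

lemma norm_localEmb_le_one (x : (placeOf p σ).1.adicCompletionIntegers F) :
    ‖localEmb p σ x‖ ≤ 1 := by
  have hd : Dense (Set.range (algebraMap F ((placeOf p σ).1.adicCompletion F))) :=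
    HeightOneSpectrum.denseRange_algebraMap F (placeOf p σ).1
  have hx := hd.open_subset_closure_inter
    (Valued.isOpen_valuationSubring ((placeOf p σ).1.adicCompletion F)) x.2
  have hc : IsClosed {y : (placeOf p σ).1.adicCompletion F | ‖localEmb p σ y‖ ≤ 1} :=
    isClosed_le (continuous_localEmb p σ).norm continuous_const
  refine closure_minimal ?_ hc hx
  rintro _ ⟨hy, a, rfl⟩
  change ‖localEmb p σ _‖ ≤ 1
  rw [localEmb_coe]
  apply norm_le_one_of_valuation_le_one p σ
  have h2 : Valued.v (algebraMap F ((placeOf p σ).1.adicCompletion F) a) ≤ 1 := hy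
  rwa [algebraMap_adicCompletion, Function.comp_apply, Algebra.algebraMap_self, RingHom.id_apply,
    valuedAdicCompletion_eq_valuation'] at h2

/-- The continuous ring homomorphism `𝔯_p → 𝒪` that extends `σ : 𝔯 → 𝒪`. -/
def embO : Rp F p →+* OK K where
  toFun x := ⟨localEmb p σ (x (placeOf p σ)), norm_localEmb_le_one p σ _⟩
  map_one' := by apply Subtype.ext; simp
  map_mul' x y := by apply Subtype.ext; simp
  map_zero' := by apply Subtype.ext; simp
  map_add' x y := by apply Subtype.ext; simp

lemma continuous_embO : Continuous (embO p σ) := by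
  refine Continuous.subtype_mk (f := fun x : Rp F p =>
    localEmb p σ (x (placeOf p σ) : (placeOf p σ).1.adicCompletion F)) ?_ _
  exact (continuous_localEmb p σ).comp (continuous_subtype_val.comp (continuous_apply _))

lemma norm_embO_unit {z : Rp F p} (hz : IsUnit z) : ‖(embO p σ z : K)‖ = 1 := by
  obtain ⟨u, rfl⟩ := hz
  have h1 : ‖((embO p σ u : OK K) : K)‖ ≤ 1 := (embO p σ u).2
  have h2 : ‖((embO p σ ((u⁻¹ : (Rp F p)ˣ) : Rp F p) : OK K) : K)‖ ≤ 1 := (embO p σ _).2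
  have h3 : ‖((embO p σ u : OK K) : K)‖ * ‖((embO p σ ((u⁻¹ : (Rp F p)ˣ) : Rp F p) : OK K) : K)‖
      = 1 := by
    rw [← norm_mul, ← Subring.coe_mul, ← map_mul, Units.mul_inv, map_one]
    simp
  nlinarith [norm_nonneg ((embO p σ u : OK K) : K)]

end

end Embeddings

section Cohomology

/-- The set `U \ U x U` of the right cosets `U s` contained in `U x U`. -/
def doubleCosets {G : Type*} [Group G] (U : Subgroup G) (x : G) : Set (Quotient (QuotientGroup.rightRel U)) :=
  {q | ∃ u ∈ U, q = Quotient.mk _ (x * u)}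

lemma finite_doubleCosets {G : Type*} [Group G] [TopologicalSpace G] [IsTopologicalGroup G]
    {U : Subgroup G} (hUo : IsOpen (U : Set G)) (hUc : IsCompact (U : Set G))
    (x : G) : (doubleCosets U x).Finite := by
  obtain ⟨t, ht⟩ := hUc.elim_finite_subcover
    (fun q : Quotient (QuotientGroup.rightRel U) => {y | Quotient.mk _ (x * y) = q})
    (fun q => by
      rw [isOpen_iff_mem_nhds]
      intro y hy
      have hcont : Continuous fun z : G => (x * z) * (x * y)⁻¹ := by fun_prop
      refine Filter.mem_of_superset ((hUo.preimage hcont).mem_nhds ?_) ?_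
      · simp
      · intro z hz
        rw [Set.mem_ofPred_eq] at hy ⊢
        rw [← hy]
        refine Quotient.sound ?_
        have := U.inv_mem hz
        rw [mul_inv_rev, inv_inv] at this
        exact QuotientGroup.rightRel_apply.2 this)
    (fun y _ => Set.mem_iUnion.2 ⟨_, rfl⟩)
  refine t.finite_toSet.subset ?_
  rintro q ⟨u, hu, rfl⟩
  obtain ⟨q, hq, h⟩ := Set.mem_iUnion₂.1 (ht hu)
  exact h ▸ hq

lemma out_mem {G : Type*} [Group G] {U : Subgroup G} {x : G} {q : Quotient (QuotientGroup.rightRel U)} (hq : q ∈ doubleCosets U x) :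
    ∃ a ∈ U, ∃ b ∈ U, q.out = a * x * b := by
  obtain ⟨u, hu, rfl⟩ := hq
  have h := QuotientGroup.rightRel_apply.1 (Quotient.mk_out (s := QuotientGroup.rightRel U) (x * u))
  refine ⟨_, U.inv_mem h, u, hu, ?_⟩
  group

lemma isCompact_mulDoubleCoset {G D : Type*} [Group G] [TopologicalSpace G] [IsTopologicalGroup G]
    [TopologicalSpace D] {C : Set (G × D)} (hC : IsCompact C) {U : Set G} (hU : IsCompact U)
    (x : G) :
    IsCompact ((fun z : ((G × D) × G) × G => (z.1.1.1 * z.1.2 * x * z.2, z.1.1.2)) ''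
      ((C ×ˢ U) ×ˢ U)) :=
  ((hC.prod hU).prod hU).image (by fun_prop)

lemma isCompact_mulInv {G D : Type*} [Group G] [TopologicalSpace G] [IsTopologicalGroup G]
    [TopologicalSpace D] {C : Set (G × D)} (hC : IsCompact C) {U : Set G} (hU : IsCompact U) :
    IsCompact ((fun z : (G × D) × G => (z.1.1 * z.2⁻¹, z.1.2)) '' (C ×ˢ U)) :=
  (hC.prod hU).image (by fun_prop)

/-- The group `ℝ₊ · SO₂(ℝ)` of the nonzero matrices `(a, b; -b, a)`. -/
def conformalGroup : Subgroup (GL (Fin 2) ℝ) where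
  carrier := {g | g 0 0 = g 1 1 ∧ g 0 1 = -g 1 0}
  one_mem' := by simp
  mul_mem' := by
    rintro g h ⟨hg, hg'⟩ ⟨hh, hh'⟩
    simp only [Set.mem_ofPred_eq, Units.val_mul, Matrix.mul_apply, Fin.sum_univ_two]
    rw [hg, hg', hh, hh']
    constructor <;> ring
  inv_mem' := by
    rintro g ⟨hg, hg'⟩
    simp only [Set.mem_ofPred_eq, GL_inv_apply, Matrix.adjugate_fin_two, Matrix.smul_apply,
      Matrix.of_apply, Matrix.cons_val', Matrix.cons_val_zero, Matrix.cons_val_one, smul_eq_mul]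
    constructor
    · exact congrArg _ hg.symm
    · change _ * (-g 0 1) = -(_ * (-g 1 0))
      rw [hg']; ring

variable (F : Type*) [Field F] [NumberField F]

/-- The archimedean part `GL₂(ℝ)^d` of `GL₂(F_𝔸)`, for a totally real field `F`. -/
abbrev GLinf : Type _ := (F →+* ℝ) → GL (Fin 2) ℝ

/-- `S_∞ = (SO₂(ℝ) ℝ₊)^d`. -/
def Sinf : Subgroup (GLinf F) := Subgroup.pi Set.univ fun _ => conformalGroup

/-- The symmetric space `GL₂(ℝ)^d / S_∞`, that is, `(ℂ ∖ ℝ)^d`. -/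
abbrev SymSpace : Type _ := GLinf F ⧸ Sinf F

variable {F}

/-- The diagonal embedding of `GL₂(F)` in `GL₂(ℝ)^d`. -/
def toGLinf : GL (Fin 2) F →* GLinf F :=
  MonoidHom.mk' (fun γ σ => Matrix.GeneralLinearGroup.map σ γ) fun γ γ' => by
    funext σ; exact map_mul _ _ _

/-- The diagonal embedding of `GL₂(F)` in `GL₂(F̂)`. -/
def toGLf : GL (Fin 2) F →* GLf F :=
  Matrix.GeneralLinearGroup.map (algebraMap F (FiniteAdeleRing (𝓞 F) F))

variable (F) in
/-- Singular `k`-simplices of the symmetric space. -/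
abbrev Simplex (k : ℕ) : Type _ := C(stdSimplex ℝ (Fin (k + 1)), SymSpace F)

/-- The translate of a singular simplex by an element of `GL₂(F)`. -/
def translate {k : ℕ} (γ : GL (Fin 2) F) (τ : Simplex F k) : Simplex F k :=
  ⟨fun t => toGLinf γ • τ t, Continuous.const_smul (map_continuous τ) (toGLinf γ)⟩

/-- The `i`-th face of a singular simplex. -/
def face {k : ℕ} (i : Fin (k + 2)) (τ : Simplex F (k + 1)) : Simplex F k :=
  ⟨fun t => τ (stdSimplex.map i.succAbove t), (map_continuous τ).comp (stdSimplex.continuous_map _)⟩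

lemma face_translate {F : Type*} [Field F] {k : ℕ} (i : Fin (k + 2)) (γ : GL (Fin 2) F) (τ : Simplex F (k + 1)) :
    face i (translate γ τ) = translate γ (face i τ) := rfl

variable {R : Type*} [CommRing R] {E : Type*} [AddCommGroup E] [Module R E]

/-- All functions of `g ∈ GL₂(F̂)` and a singular `k`-simplex, with values in `E`. -/
def CochainFun (F : Type*) [Field F] [NumberField F] (E : Type*) (k : ℕ) : Type _ :=
  GLf F → Simplex F k → E

instance (k : ℕ) : AddCommGroup (CochainFun F E k) :=
  inferInstanceAs (AddCommGroup (GLf F → Simplex F k → E))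

instance (k : ℕ) : Module R (CochainFun F E k) :=
  inferInstanceAs (Module R (GLf F → Simplex F k → E))

@[simp] lemma CochainFun.add_apply {F : Type*} [Field F] [NumberField F] {E : Type*}
    [AddCommGroup E] {k : ℕ} (c c' : CochainFun F E k) (g : GLf F) (τ : Simplex F k) :
    (c + c') g τ = c g τ + c' g τ := rfl

@[simp] lemma CochainFun.smul_apply {k : ℕ} (r : R) (c : CochainFun F E k) (g : GLf F)
    (τ : Simplex F k) : (r • c) g τ = r • c g τ := rfl

@[simp] lemma CochainFun.zero_apply {F : Type*} [Field F] [NumberField F] {E : Type*}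
    [AddCommGroup E] {k : ℕ} (g : GLf F) (τ : Simplex F k) :
    (0 : CochainFun F E k) g τ = 0 := rfl

/-- Compactly supported singular `k`-cochains on
`X_U = GL₂(F) \ GL₂(F_𝔸) / (U · S_∞)` with values in the local system attached to a module `E`
on which `u ∈ U` operates on the right by `act u`. A singular simplex of `GL₂(F_𝔸) / (U · S_∞)` is
a pair `(g U, τ)` with `g ∈ GL₂(F̂)` and `τ` a singular simplex of the symmetric space; a cochain is
a function of `(g, τ)` with `c (γ g) (γ τ) = c g τ` for `γ ∈ GL₂(F)` and
`c (g u) τ = c g τ | u` for `u ∈ U`, and it has compact support if it vanishes on all the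
simplices of `X_U` that do not meet a suitable compact subset (the image of `C`) of `X_U`. -/
def Cochain (U : Subgroup (GLf F)) (act : GLf F → E →ₗ[R] E) (k : ℕ) :
    Submodule R (CochainFun F E k) where
  carrier := {c | (∀ γ g τ, c (toGLf γ * g) (translate γ τ) = c g τ) ∧
    (∀ u ∈ U, ∀ g τ, c (g * u) τ = act u (c g τ)) ∧
    ∃ C : Set (GLf F × SymSpace F), IsCompact C ∧ ∀ g τ, c g τ ≠ 0 →
      ∃ (γ : GL (Fin 2) F) (u : GLf F) (t : stdSimplex ℝ (Fin (k + 1))),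
        u ∈ U ∧ (toGLf γ * g * u, toGLinf γ • τ t) ∈ C}
  zero_mem' := ⟨fun _ _ _ => rfl, fun u _ g τ => by simp, ∅, isCompact_empty,
    fun g τ h => absurd rfl h⟩
  add_mem' := by
    rintro c c' ⟨h1, h2, C, hC, h3⟩ ⟨h1', h2', C', hC', h3'⟩
    refine ⟨fun γ g τ => by simp [h1, h1'], fun u hu g τ => by simp [h2 u hu, h2' u hu],
      C ∪ C', hC.union hC', fun g τ h => ?_⟩
    by_cases hc : c g τ = 0
    · have hc' : c' g τ ≠ 0 := fun h0 => h (by simp [hc, h0])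
      obtain ⟨γ, u, t, hu, ht⟩ := h3' g τ hc'
      exact ⟨γ, u, t, hu, Or.inr ht⟩
    · obtain ⟨γ, u, t, hu, ht⟩ := h3 g τ hc
      exact ⟨γ, u, t, hu, Or.inl ht⟩
  smul_mem' := by
    rintro r c ⟨h1, h2, C, hC, h3⟩
    refine ⟨fun γ g τ => by simp [h1], fun u hu g τ => by simp [h2 u hu], C, hC, fun g τ h => ?_⟩
    exact h3 g τ fun h0 => h (by simp [h0])

variable {U : Subgroup (GLf F)} {act : GLf F → E →ₗ[R] E}

/-- The singular coboundary. -/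
def coboundary (U : Subgroup (GLf F)) (act : GLf F → E →ₗ[R] E) (k : ℕ) :
    Cochain U act k →ₗ[R] Cochain U act (k + 1) where
  toFun c := ⟨fun g τ => ∑ i : Fin (k + 2), (-1 : R) ^ (i : ℕ) • c.1 g (face i τ), by
    obtain ⟨c, h1, h2, C, hC, h3⟩ := c
    refine ⟨fun γ g τ => ?_, fun u hu g τ => ?_, C, hC, fun g τ h => ?_⟩
    · simp only [face_translate, h1]
    · simp only [map_sum, map_smul, h2 u hu]
    · obtain ⟨i, -, hi⟩ := Finset.exists_ne_zero_of_sum_ne_zero h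
      obtain ⟨γ, u, t, hu, ht⟩ := h3 g (face i τ) fun h0 => hi (by simp [h0])
      exact ⟨γ, u, stdSimplex.map i.succAbove t, hu, ht⟩⟩
  map_add' c c' := by
    apply Subtype.ext; funext g τ
    change ∑ i : Fin (k + 2), (-1 : R) ^ (i : ℕ) • (c.1 g (face i τ) + c'.1 g (face i τ)) =
      ∑ i : Fin (k + 2), (-1 : R) ^ (i : ℕ) • c.1 g (face i τ) +
        ∑ i : Fin (k + 2), (-1 : R) ^ (i : ℕ) • c'.1 g (face i τ)
    simp only [smul_add, Finset.sum_add_distrib]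
  map_smul' r c := by
    apply Subtype.ext; funext g τ
    change ∑ i : Fin (k + 2), (-1 : R) ^ (i : ℕ) • (r • c.1 g (face i τ)) =
      r • ∑ i : Fin (k + 2), (-1 : R) ^ (i : ℕ) • c.1 g (face i τ)
    simp only [Finset.smul_sum, smul_comm r]

/-- The coboundaries in degree `k`. -/
def boundaries (U : Subgroup (GLf F)) (act : GLf F → E →ₗ[R] E) :
    ∀ k : ℕ, Submodule R (Cochain U act k)
  | 0 => ⊥
  | k + 1 => LinearMap.range (coboundary U act k)

/-- The cohomology with compact support `H^k_cpt(X_U, ℰ)`. -/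
abbrev Hcpt (U : Subgroup (GLf F)) (act : GLf F → E →ₗ[R] E) (k : ℕ) : Type _ :=
  LinearMap.ker (coboundary U act k) ⧸
    (boundaries U act k).comap (LinearMap.ker (coboundary U act k)).subtype

/-- The map induced in cohomology by a map of complexes. -/
def Hcpt.map {E' : Type*} [AddCommGroup E'] [Module R E'] {U' : Subgroup (GLf F)}
    {act' : GLf F → E' →ₗ[R] E'}
    (f : ∀ k, Cochain U act k →ₗ[R] Cochain U' act' k)
    (hf : ∀ k c, f (k + 1) (coboundary U act k c) = coboundary U' act' k (f k c)) (k : ℕ) :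
    Hcpt U act k →ₗ[R] Hcpt U' act' k :=
  Submodule.mapQ _ _
    ((f k).restrict (p := LinearMap.ker (coboundary U act k))
      (q := LinearMap.ker (coboundary U' act' k)) fun c hc => by
        rw [LinearMap.mem_ker] at hc ⊢
        rw [← hf, hc, map_zero])
    (by
      rintro ⟨c, hc⟩ h
      rw [Submodule.mem_comap] at h
      rw [Submodule.mem_comap, Submodule.mem_comap]
      change c ∈ boundaries U act k at h
      change f k c ∈ boundaries U' act' k
      cases k with
      | zero =>
        change c = 0 at h
        change f 0 c = 0
        rw [h, map_zero]
      | succ k =>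
        obtain ⟨b, rfl⟩ := h
        exact ⟨f k b, (hf k b).symm⟩)

/-- The map of cochains induced by an equivariant map of coefficients `f : E → E'` and the
projection `X_{U'} → X_U`, for `U' ≤ U` and `U` compact. -/
def pushCochain {E' : Type*} [AddCommGroup E'] [Module R E'] {U' : Subgroup (GLf F)}
    {act' : GLf F → E' →ₗ[R] E'} (hU : U' ≤ U) (hc : IsCompact (U : Set (GLf F)))
    (f : E →ₗ[R] E') (hf : ∀ u ∈ U', ∀ e, f (act u e) = act' u (f e)) (k : ℕ) :
    Cochain U act k →ₗ[R] Cochain U' act' k where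
  toFun c := ⟨fun g τ => f (c.1 g τ), by
    obtain ⟨c, h1, h2, C, hC, h3⟩ := c
    refine ⟨fun γ g τ => by simp only [h1], fun u hu g τ => by simp only [h2 u (hU hu), hf u hu],
      _, isCompact_mulInv hC hc, fun g τ h => ?_⟩
    obtain ⟨γ, u, t, hu, ht⟩ := h3 g τ fun h0 => h (by simp [h0])
    exact ⟨γ, 1, t, one_mem _, ((_, _), u), ⟨ht, hu⟩, by simp⟩⟩
  map_add' c c' := by
    apply Subtype.ext; funext g τ
    exact map_add f (c.1 g τ) (c'.1 g τ)
  map_smul' r c := by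
    apply Subtype.ext; funext g τ
    exact map_smul f r (c.1 g τ)

/-- A family of operators `op s` on `E`, for `s ∈ U x U`, that is compatible on both sides with
the right operation of `U` on `E`. -/
def HeckeCompat (U : Subgroup (GLf F)) (act : GLf F → E →ₗ[R] E) (x : GLf F)
    (op : GLf F → E →ₗ[R] E) : Prop :=
  ∀ a ∈ U, ∀ b ∈ U, ∀ u ∈ U,
    op (u * (a * x * b)) = op (a * x * b) ∘ₗ act u ∧
    op (a * x * b * u) = act u ∘ₗ op (a * x * b)

/-- The sum `∑ c(g s⁻¹, τ) | s` over the right cosets `U s ⊆ U x U`. -/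
def heckeFun (U : Subgroup (GLf F)) (x : GLf F) (op : GLf F → E →ₗ[R] E) {k : ℕ}
    (c : CochainFun F E k) : CochainFun F E k :=
  fun g τ => ∑ᶠ q ∈ doubleCosets U x, op q.out (c (g * q.out⁻¹) τ)

/-- The summand of a Hecke operator depends only on the coset. -/
lemma heckeTerm_eq {x : GLf F} {op : GLf F → E →ₗ[R] E} (hop : HeckeCompat U act x op) {k : ℕ}
    (c : Cochain U act k) (g : GLf F) (τ : Simplex F k) {s s' : GLf F}
    (hs : ∃ a ∈ U, ∃ b ∈ U, s = a * x * b)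
    (h : Quotient.mk (QuotientGroup.rightRel U) s = Quotient.mk _ s') :
    op s' (c.1 (g * s'⁻¹) τ) = op s (c.1 (g * s⁻¹) τ) := by
  obtain ⟨a, ha, b, hb, rfl⟩ := hs
  have hu := QuotientGroup.rightRel_apply.1 (Quotient.exact h)
  obtain ⟨u, hu', rfl⟩ : ∃ u ∈ U, s' = u * (a * x * b) := ⟨_, hu, by group⟩
  rw [(hop a ha b hb u hu').1, LinearMap.comp_apply, ← c.2.2.1 u hu']
  congr 3
  group

lemma heckeFun_mem (hUo : IsOpen (U : Set (GLf F))) (hUc : IsCompact (U : Set (GLf F)))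
    {x : GLf F} {op : GLf F → E →ₗ[R] E} (hop : HeckeCompat U act x op) {k : ℕ}
    (c : Cochain U act k) : heckeFun U x op c.1 ∈ Cochain U act k := by
  have hfin := finite_doubleCosets hUo hUc x
  obtain ⟨h1, h2, C, hC, h3⟩ := c.2
  refine ⟨fun γ g τ => ?_, fun u hu g τ => ?_, ?_⟩
  · simp only [heckeFun, mul_assoc, h1]
  · rw [heckeFun, heckeFun, ← LinearMap.toAddMonoidHom_coe, AddMonoidHom.map_finsum_mem _ _ hfin]
    refine finsum_mem_eq_of_bijOn
      (fun q => Quotient.map' (s₂ := QuotientGroup.rightRel U) (fun s => s * u⁻¹)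
        (fun s s' h => by
          rw [QuotientGroup.rightRel_apply] at h ⊢
          simpa [mul_assoc] using h) q) ?_ ?_
    · refine ⟨?_, ?_, ?_⟩
      · rintro q ⟨b, hb, rfl⟩
        exact ⟨b * u⁻¹, U.mul_mem hb (U.inv_mem hu),
          congrArg (Quotient.mk _) (mul_assoc x b u⁻¹)⟩
      · rintro ⟨s⟩ - ⟨s'⟩ - h
        have h := QuotientGroup.rightRel_apply.1 (Quotient.exact h)
        exact Quotient.sound (QuotientGroup.rightRel_apply.2 (by simpa [mul_assoc] using h))
      · rintro q ⟨b, hb, rfl⟩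
        exact ⟨Quotient.mk _ (x * (b * u)), ⟨b * u, U.mul_mem hb hu, rfl⟩,
          congrArg (Quotient.mk _) (show x * (b * u) * u⁻¹ = x * b by group)⟩
    · intro q hq
      obtain ⟨a, ha, b, hb, hab⟩ := out_mem hq
      have hs : ∃ a' ∈ U, ∃ b' ∈ U, q.out * u⁻¹ = a' * x * b' :=
        ⟨a, ha, b * u⁻¹, U.mul_mem hb (U.inv_mem hu), by rw [hab]; group⟩
      have hmk : Quotient.mk (QuotientGroup.rightRel U) (q.out * u⁻¹) =
          Quotient.mk _ (Quotient.map' (s₂ := QuotientGroup.rightRel U) (fun s => s * u⁻¹)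
        (fun s s' h => by
          rw [QuotientGroup.rightRel_apply] at h ⊢
          simpa [mul_assoc] using h) q).out := by
        rw [Quotient.out_eq]
        conv_rhs => rw [← Quotient.out_eq q]
        rfl
      change _ = act u _
      rw [heckeTerm_eq hop c g τ hs hmk]
      obtain ⟨a', ha', b', hb', hab'⟩ := hs
      have h4 := (hop a' ha' b' hb' u hu).2
      rw [← hab', inv_mul_cancel_right] at h4
      rw [h4, LinearMap.comp_apply]
      congr 4
      group
  · refine ⟨_, isCompact_mulDoubleCoset hC hUc x, fun g τ h => ?_⟩
    obtain ⟨q, hq, hne⟩ := exists_ne_zero_of_finsum_mem_ne_zero h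
    obtain ⟨a, ha, b, hb, hab⟩ := out_mem hq
    obtain ⟨γ, u, t, hu, ht⟩ := h3 (g * q.out⁻¹) τ fun h0 => hne (by simp [h0])
    refine ⟨γ, 1, t, one_mem _, ((_, u⁻¹ * a), b), ⟨⟨ht, U.mul_mem (U.inv_mem hu) ha⟩, hb⟩, ?_⟩
    ext1
    · change toGLf γ * (g * q.out⁻¹) * u * (u⁻¹ * a) * x * b = toGLf γ * g * 1
      rw [hab]; group
    · rfl

/-- The Hecke operator of the double coset `U x U`, on cochains. -/
def heckeCochain (hUo : IsOpen (U : Set (GLf F))) (hUc : IsCompact (U : Set (GLf F)))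
    (x : GLf F) (op : GLf F → E →ₗ[R] E) (hop : HeckeCompat U act x op) (k : ℕ) :
    Cochain U act k →ₗ[R] Cochain U act k where
  toFun c := ⟨heckeFun U x op c.1, heckeFun_mem hUo hUc hop c⟩
  map_add' c c' := by
    apply Subtype.ext; funext g τ
    change ∑ᶠ q ∈ doubleCosets U x, op q.out (c.1 (g * q.out⁻¹) τ + c'.1 (g * q.out⁻¹) τ) =
      ∑ᶠ q ∈ doubleCosets U x, op q.out (c.1 (g * q.out⁻¹) τ) +
        ∑ᶠ q ∈ doubleCosets U x, op q.out (c'.1 (g * q.out⁻¹) τ)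
    simp only [map_add]
    exact finsum_mem_add_distrib (finite_doubleCosets hUo hUc x)
  map_smul' r c := by
    apply Subtype.ext; funext g τ
    change ∑ᶠ q ∈ doubleCosets U x, op q.out (r • c.1 (g * q.out⁻¹) τ) =
      r • ∑ᶠ q ∈ doubleCosets U x, op q.out (c.1 (g * q.out⁻¹) τ)
    simp only [map_smul]
    exact ((DistribSMul.toAddMonoidHom E r).map_finsum_mem _
      (finite_doubleCosets hUo hUc x)).symm

lemma heckeCochain_coboundary (hUo : IsOpen (U : Set (GLf F))) (hUc : IsCompact (U : Set (GLf F)))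
    (x : GLf F) (op : GLf F → E →ₗ[R] E) (hop : HeckeCompat U act x op) (k : ℕ)
    (c : Cochain U act k) :
    heckeCochain hUo hUc x op hop (k + 1) (coboundary U act k c) =
      coboundary U act k (heckeCochain hUo hUc x op hop k c) := by
  apply Subtype.ext; funext g τ
  change ∑ᶠ q ∈ doubleCosets U x,
      op q.out (∑ i : Fin (k + 2), (-1 : R) ^ (i : ℕ) • c.1 (g * q.out⁻¹) (face i τ)) =
    ∑ i : Fin (k + 2), (-1 : R) ^ (i : ℕ) •
      ∑ᶠ q ∈ doubleCosets U x, op q.out (c.1 (g * q.out⁻¹) (face i τ))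
  have hfin := finite_doubleCosets hUo hUc x
  simp only [finsum_mem_eq_finite_toFinset_sum _ hfin, map_sum, map_smul, Finset.smul_sum]
  exact Finset.sum_comm

/-- The Hecke operator of the double coset `U x U` on `H^k_cpt(X_U, ℰ)`, where `s ∈ U x U`
operates on the coefficients by `op s`. -/
def hecke (hUo : IsOpen (U : Set (GLf F))) (hUc : IsCompact (U : Set (GLf F)))
    (x : GLf F) (op : GLf F → E →ₗ[R] E) (hop : HeckeCompat U act x op) (k : ℕ) :
    Hcpt U act k →ₗ[R] Hcpt U act k :=
  Hcpt.map (heckeCochain hUo hUc x op hop) (heckeCochain_coboundary hUo hUc x op hop) k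

end Cohomology

section Measures

variable (F : Type*) [Field F] [NumberField F] (p : ℕ)

/-- The tame level: an ideal `𝔫 ≠ 0` prime to `p` and an open compact subgroup `S` of `GL₂(F̂)`
with `U₁(𝔫) ⊆ S ⊆ U₀(𝔫)` (so that the `p`-component of `S` is `GL₂(𝔯_p)`), such that the groups
`Γ / (Γ ∩ F^×)` are torsion-free, where `Γ = g S g⁻¹ ∩ GL₂⁺(F)` and `g ∈ GL₂(F̂)`. -/
structure TameLevel where
  /-- the ideal `𝔫` -/
  cond : Ideal (𝓞 F)
  cond_ne_bot : cond ≠ ⊥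
  cond_coprime : IsCoprime (Ideal.span {(p : 𝓞 F)}) cond
  /-- the group `S` -/
  S : Subgroup (GLf F)
  isOpen : IsOpen (S : Set (GLf F))
  isCompact : IsCompact (S : Set (GLf F))
  U1_le : U1 cond ≤ S
  le_U0 : S ≤ U0 cond
  torsionFree : ∀ (g : GLf F) (γ : GL (Fin 2) F),
    (∀ σ : F →+* ℝ, 0 < σ (γ.det : Fˣ)) → g⁻¹ * toGLf γ * g ∈ S →
    ∀ k : ℕ, 0 < k → γ ^ k ∈ (Matrix.GeneralLinearGroup.scalar (R := F) (Fin 2)).range →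
      γ ∈ (Matrix.GeneralLinearGroup.scalar (R := F) (Fin 2)).range

variable {F p} (S : TameLevel F p)

lemma TameLevel.le_U0_top : S.S ≤ U0 (⊤ : Ideal (𝓞 F)) := S.le_U0.trans (U0_mono le_top)

/-- The image of `𝔢 = S ∩ F^×` in `𝔯_p^×`. -/
def TameLevel.unitsE : Subgroup (Rp F p)ˣ where
  carrier := {z | ∃ e : Fˣ, toGLf (Matrix.GeneralLinearGroup.scalar (Fin 2) e) ∈ S.S ∧
    ∀ w : PlaceAbove F p, (((z : Rp F p) w : w.1.adicCompletionIntegers F) : w.1.adicCompletion F) =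
      algebraMap F (w.1.adicCompletion F) e}
  one_mem' := ⟨1, by simp, fun w => by simp⟩
  mul_mem' := by
    rintro z z' ⟨e, he, h⟩ ⟨e', he', h'⟩
    exact ⟨e * e', by simpa using S.S.mul_mem he he', fun w => by simp [h w, h' w]⟩
  inv_mem' := by
    rintro z ⟨e, he, h⟩
    refine ⟨e⁻¹, by simpa using S.S.inv_mem he, fun w => ?_⟩
    have h1 : (((z : Rp F p) w : w.1.adicCompletionIntegers F) : w.1.adicCompletion F) *
        ((((z⁻¹ : (Rp F p)ˣ) : Rp F p) w : w.1.adicCompletionIntegers F) :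
          w.1.adicCompletion F) = 1 := by
      rw [← MulMemClass.coe_mul, ← Pi.mul_apply, Units.mul_inv]
      rfl
    rw [h w] at h1
    rw [Units.val_inv_eq_inv_val, map_inv₀]
    exact eq_inv_of_mul_eq_one_right h1

/-- The closure `ē` of `𝔢 = S ∩ F^×` in `𝔯_p^×`. -/
def TameLevel.ebar : Subgroup (Rp F p)ˣ := S.unitsE.topologicalClosure

/-- The condition that `((x, y), z)` lies in `(𝔯_p²)' × 𝔯_p^×`, where `(𝔯_p²)'` is the set of the
primitive vectors. -/
def InX (η : Rp F p × Rp F p × Rp F p) : Prop :=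
  (∀ w, IsUnit (η.1 w) ∨ IsUnit (η.2.1 w)) ∧ IsUnit η.2.2

/-- The operation `e · ((x, y), z) = ((e x, e y), e² z)`. -/
def scaleX (e : Rp F p) (η : Rp F p × Rp F p × Rp F p) : Rp F p × Rp F p × Rp F p :=
  (e * η.1, e * η.2.1, e ^ 2 * η.2.2)

lemma inX_scale (e : (Rp F p)ˣ) (η : Rp F p × Rp F p × Rp F p) :
    InX (scaleX (e : Rp F p) η) ↔ InX η := by
  have he : ∀ w, IsUnit ((e : Rp F p) w) := fun w => (Pi.isUnit_iff.1 e.isUnit) w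
  simp [InX, scaleX, he]

/-- The space `X = ē \ ((𝔯_p²)' × 𝔯_p^×)`, identified with `NC \ GL₂(𝔯_p)` by
`(a, b; c, d) ↦ ((a, b), ad - bc)`. -/
def TameLevel.setoidX : Setoid {η : Rp F p × Rp F p × Rp F p // InX η} where
  r η η' := ∃ e ∈ S.ebar, η'.1 = scaleX (e : Rp F p) η.1
  iseqv :=
    { refl := fun η => ⟨1, one_mem _, by simp [scaleX]⟩
      symm := by
        rintro η η' ⟨e, he, h⟩
        refine ⟨e⁻¹, inv_mem he, ?_⟩
        rw [h]
        ext1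
        · simp [scaleX]
        · ext1 <;> simp [scaleX, ← mul_assoc, ← mul_pow]
      trans := by
        rintro η η' η'' ⟨e, he, h⟩ ⟨e', he', h'⟩
        refine ⟨e' * e, mul_mem he' he, ?_⟩
        rw [h', h]
        simp [scaleX, mul_assoc, mul_pow] }

/-- The space `X = ē \ ((𝔯_p²)' × 𝔯_p^×)`, identified with `NC \ GL₂(𝔯_p)` by
`(a, b; c, d) ↦ ((a, b), ad - bc)`; it carries the quotient topology. -/
abbrev TameLevel.X : Type _ := Quotient S.setoidX

variable {K : Type*} [NormedField K] [IsUltrametricDist K]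

/-- A continuous function on `X`, as a function on all triples, extended by zero. -/
def extendX (φ : C(S.X, OK K)) (η : Rp F p × Rp F p × Rp F p) : OK K :=
  open Classical in if h : InX η then φ (Quotient.mk S.setoidX ⟨η, h⟩) else 0

lemma extendX_scale (φ : C(S.X, OK K)) {e : (Rp F p)ˣ} (he : e ∈ S.ebar)
    (η : Rp F p × Rp F p × Rp F p) : extendX S φ (scaleX (e : Rp F p) η) = extendX S φ η := by
  by_cases h : InX η
  · have h' : InX (scaleX (e : Rp F p) η) := (inX_scale e η).2 h
    simp only [extendX, h, h', dif_pos]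
    congr 1
    exact (Quotient.sound (s := S.setoidX) ⟨e, he, rfl⟩).symm
  · have h' : ¬ InX (scaleX (e : Rp F p) η) := fun h2 => h ((inX_scale e η).1 h2)
    simp only [extendX, h, h', dif_neg, not_false_eq_true]

lemma finite_placeAbove [Fact p.Prime] : Finite (PlaceAbove F p) := by
  have h0 : Ideal.span {(p : 𝓞 F)} ≠ 0 := by
    simpa using (Fact.out : p.Prime).ne_zero
  refine (Set.Finite.subset (Ideal.finite_factors h0) ?_).to_subtype
  intro w hw
  exact Ideal.dvd_span_singleton.2 hw

lemma isClopen_isUnit (w : HeightOneSpectrum (𝓞 F)) :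
    IsClopen {x : w.adicCompletionIntegers F | IsUnit x} := by
  have h := Valued.isClopen_sphere (w.adicCompletion F) (Γ₀ := WithZero (Multiplicative ℤ))
    (r := 1) one_ne_zero
  have h2 := h.preimage (f := fun x : w.adicCompletionIntegers F => (x : w.adicCompletion F))
    continuous_subtype_val
  convert h2 using 1
  ext x
  simp only [Set.mem_ofPred_eq, Set.mem_preimage, Valuation.restrict_eq_one_iff]
  exact adicCompletionIntegers.isUnit_iff_valued_eq_one

lemma isClopen_inX [Fact p.Prime] : IsClopen {η : Rp F p × Rp F p × Rp F p | InX η} := by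
  have := finite_placeAbove (F := F) (p := p)
  have h1 : ∀ w : PlaceAbove F p, IsClopen {η : Rp F p × Rp F p × Rp F p |
      IsUnit (η.1 w) ∨ IsUnit (η.2.1 w)} := fun w =>
    ((isClopen_isUnit w.1).preimage (f := fun η : Rp F p × Rp F p × Rp F p => η.1 w)
      (by fun_prop)).union
    ((isClopen_isUnit w.1).preimage (f := fun η : Rp F p × Rp F p × Rp F p => η.2.1 w)
      (by fun_prop))
  have h2 : ∀ w : PlaceAbove F p, IsClopen {η : Rp F p × Rp F p × Rp F p |
      IsUnit (η.2.2 w)} := fun w =>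
    ((isClopen_isUnit w.1).preimage (f := fun η : Rp F p × Rp F p × Rp F p => η.2.2 w)
      (by fun_prop))
  have h3 := (isClopen_iInter_of_finite h1).inter (isClopen_iInter_of_finite h2)
  convert h3 using 1
  ext η
  simp [InX, Pi.isUnit_iff]

lemma continuous_extendX [Fact p.Prime] (φ : C(S.X, OK K)) : Continuous (extendX S φ) := by
  rw [continuous_iff_continuousAt]
  intro η
  by_cases h : InX η
  · have hopen : IsOpen {η : Rp F p × Rp F p × Rp F p | InX η} := isClopen_inX.isOpen
    have he := hopen.isOpenEmbedding_subtypeVal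
    rw [show η = ((⟨η, h⟩ : {η : Rp F p × Rp F p × Rp F p | InX η}) :
      Rp F p × Rp F p × Rp F p) from rfl, ← he.continuousAt_iff]
    have hfun : (extendX S φ ∘ Subtype.val : {η : Rp F p × Rp F p × Rp F p | InX η} → OK K) =
        fun η => φ (Quotient.mk S.setoidX η) := by
      funext η
      have : InX η.1 := η.2
      simp [extendX, this]
    rw [hfun]
    exact ((map_continuous φ).comp continuous_quotient_mk').continuousAt
  · have hopen : IsOpen {η : Rp F p × Rp F p × Rp F p | InX η}ᶜ := isClopen_inX.compl.isOpen
    refine ContinuousAt.congr (f := fun _ => (0 : OK K)) continuousAt_const ?_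
    filter_upwards [hopen.mem_nhds h] with η' h'
    have : ¬ InX η' := h'
    simp [extendX, this]

variable (p) in
/-- The element `∏ π_𝔭^{-c(𝔭)} det s` of `𝔯_p`, where `c(𝔭)` is the valuation of `det s` at `𝔭`
and `p` serves as the uniformizer at all the `𝔭 ∣ p`; note that `WithZero.log` of the value of an
element of valuation `c` is `-c`. -/
def unitPart (s : GLf F) : Rp F p := fun w =>
  toInt w.1 (evalAt w.1 (s.det : (FiniteAdeleRing (𝓞 F) F)ˣ) *
    (p : w.1.adicCompletion F) ^
      WithZero.log (Valued.v (evalAt w.1 (s.det : (FiniteAdeleRing (𝓞 F) F)ˣ))))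

variable (p) in
/-- The `*`-operation `((x, y), z) * s = ((x, y) s, z · ∏ π_𝔭^{-c(𝔭)} det s)` of matrices that are
integral at `p`. -/
def starX (s : GLf F) (η : Rp F p × Rp F p × Rp F p) : Rp F p × Rp F p × Rp F p :=
  (η.1 * pMat p s 0 0 + η.2.1 * pMat p s 1 0, η.1 * pMat p s 0 1 + η.2.1 * pMat p s 1 1,
    η.2.2 * unitPart p s)

lemma starX_scale (s : GLf F) (e : Rp F p) (η : Rp F p × Rp F p × Rp F p) :
    starX p s (scaleX e η) = scaleX e (starX p s η) := by
  simp only [starX, scaleX, mul_add, mul_assoc]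

lemma evalAt_det {s : GLf F} (hs : s ∈ Delta0 (⊤ : Ideal (𝓞 F))) (w : PlaceAbove F p) :
    evalAt w.1 (s.det : (FiniteAdeleRing (𝓞 F) F)ˣ) =
      (((pMat p s).det w : w.1.adicCompletionIntegers F) : w.1.adicCompletion F) := by
  rw [Matrix.det_fin_two, Matrix.GeneralLinearGroup.val_det_apply, Matrix.det_fin_two]
  simp only [Pi.sub_apply, Pi.mul_apply, AddSubgroupClass.coe_sub, MulMemClass.coe_mul,
    pMat_coe p hs]
  rfl

lemma valued_det_unit {u : GLf F} (hu : u ∈ U0 (⊤ : Ideal (𝓞 F))) (w : PlaceAbove F p) :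
    Valued.v (evalAt w.1 (u.det : (FiniteAdeleRing (𝓞 F) F)ˣ)) = 1 := by
  rw [evalAt_det (U0_le_Delta0 _ u hu)]
  exact adicCompletionIntegers.isUnit_iff_valued_eq_one.1
    (Pi.isUnit_iff.1 (isUnit_det_pMat p hu) w)

lemma unitPart_mul_unit (s : GLf F) {u : GLf F} (hu : u ∈ U0 (⊤ : Ideal (𝓞 F))) :
    unitPart p (s * u) = unitPart p s * (pMat p u).det := by
  funext w
  have h1 : IsUnit ((pMat p u).det w) := Pi.isUnit_iff.1 (isUnit_det_pMat p hu) w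
  obtain ⟨v, hv⟩ := h1
  rw [Pi.mul_apply, ← hv, unitPart, unitPart, ← toInt_mul_unit]
  congr 1
  rw [map_mul, Units.val_mul, map_mul, map_mul, valued_det_unit hu w, mul_one,
    evalAt_det (U0_le_Delta0 _ u hu), ← hv]
  ring

lemma unitPart_unit_mul (s : GLf F) {u : GLf F} (hu : u ∈ U0 (⊤ : Ideal (𝓞 F))) :
    unitPart p (u * s) = (pMat p u).det * unitPart p s := by
  rw [mul_comm, ← unitPart_mul_unit s hu]
  funext w
  simp only [unitPart, map_mul, mul_comm]

lemma unitPart_unit {u : GLf F} (hu : u ∈ U0 (⊤ : Ideal (𝓞 F))) :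
    unitPart p u = (pMat p u).det := by
  have h := unitPart_mul_unit (p := p) 1 hu
  rw [one_mul] at h
  rw [h]
  have h1 : unitPart p (1 : GLf F) = 1 := by
    funext w
    have : (1 : w.1.adicCompletion F) = ((1 : w.1.adicCompletionIntegers F) : w.1.adicCompletion F) :=
      rfl
    simp only [unitPart, map_one, Units.val_one, WithZero.log_one, zpow_zero, mul_one, Pi.one_apply]
    rw [this, toInt_coe]
  rw [h1, one_mul]

lemma starX_mul_unit {s u : GLf F} (hs : s ∈ Delta0 (⊤ : Ideal (𝓞 F)))
    (hu : u ∈ U0 (⊤ : Ideal (𝓞 F))) (η : Rp F p × Rp F p × Rp F p) :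
    starX p (s * u) η = starX p u (starX p s η) := by
  simp only [starX, unitPart_mul_unit s hu, unitPart_unit hu, pMat_mul p hs (U0_le_Delta0 _ u hu),
    Matrix.mul_apply, Fin.sum_univ_two]
  ext1
  · dsimp only; ring
  · ext1 <;> dsimp only <;> ring

lemma starX_unit_mul {s u : GLf F} (hs : s ∈ Delta0 (⊤ : Ideal (𝓞 F)))
    (hu : u ∈ U0 (⊤ : Ideal (𝓞 F))) (η : Rp F p × Rp F p × Rp F p) :
    starX p (u * s) η = starX p s (starX p u η) := by
  simp only [starX, unitPart_unit_mul s hu, unitPart_unit hu, pMat_mul p (U0_le_Delta0 _ u hu) hs,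
    Matrix.mul_apply, Fin.sum_univ_two]
  ext1
  · dsimp only; ring
  · ext1 <;> dsimp only <;> ring

lemma starX_one (η : Rp F p × Rp F p × Rp F p) : starX p (1 : GLf F) η = η := by
  have h := unitPart_unit (p := p) (U0 (⊤ : Ideal (𝓞 F))).one_mem
  simp [starX, h]

lemma inX_starX_unit {u : GLf F} (hu : u ∈ U0 (⊤ : Ideal (𝓞 F)))
    (η : Rp F p × Rp F p × Rp F p) : InX (starX p u η) ↔ InX η := by
  have key : ∀ {u : GLf F}, u ∈ U0 (⊤ : Ideal (𝓞 F)) → ∀ η : Rp F p × Rp F p × Rp F p,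
      InX η → InX (starX p u η) := by
    intro u hu η hη
    refine ⟨fun w => ?_, ?_⟩
    · by_contra! hcon
      have hdet : pMat p u * pMat p u⁻¹ = 1 := by
        rw [← pMat_mul p (U0_le_Delta0 _ u hu) (U0_le_Delta0 _ _ (inv_mem hu)), mul_inv_cancel,
          pMat_one]
      have hstar : starX p u⁻¹ (starX p u η) = η := by
        rw [← starX_mul_unit (U0_le_Delta0 _ u hu) (inv_mem hu), mul_inv_cancel, starX_one]
      have hm1 : (starX p u η).1 w ∈ IsLocalRing.maximalIdeal (w.1.adicCompletionIntegers F) :=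
        hcon.1
      have hm2 : (starX p u η).2.1 w ∈ IsLocalRing.maximalIdeal (w.1.adicCompletionIntegers F) :=
        hcon.2
      have e1 : η.1 w = (starX p u η).1 w * pMat p u⁻¹ 0 0 w +
          (starX p u η).2.1 w * pMat p u⁻¹ 1 0 w := by
        conv_lhs => rw [← hstar]
        rfl
      have e2 : η.2.1 w = (starX p u η).1 w * pMat p u⁻¹ 0 1 w +
          (starX p u η).2.1 w * pMat p u⁻¹ 1 1 w := by
        conv_lhs => rw [← hstar]
        rfl
      rcases hη.1 w with h | h
      · rw [e1] at h
        exact (Ideal.add_mem _ (Ideal.mul_mem_right _ _ hm1) (Ideal.mul_mem_right _ _ hm2) :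
          _ ∈ IsLocalRing.maximalIdeal (w.1.adicCompletionIntegers F)) h
      · rw [e2] at h
        exact (Ideal.add_mem _ (Ideal.mul_mem_right _ _ hm1) (Ideal.mul_mem_right _ _ hm2) :
          _ ∈ IsLocalRing.maximalIdeal (w.1.adicCompletionIntegers F)) h
    · change IsUnit (η.2.2 * unitPart p u)
      rw [unitPart_unit hu]
      exact hη.2.mul (isUnit_det_pMat p hu)
  refine ⟨fun h => ?_, key hu η⟩
  have := key (inv_mem hu) _ h
  rwa [← starX_mul_unit (U0_le_Delta0 _ u hu) (inv_mem hu), mul_inv_cancel, starX_one] at this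

lemma continuous_rowMul {A : Type*} [CommRing A] [TopologicalSpace A] [IsTopologicalRing A]
    (a b c d e : A) : Continuous fun η : A × A × A =>
      (η.1 * a + η.2.1 * c, η.1 * b + η.2.1 * d, η.2.2 * e) := by
  fun_prop

lemma continuous_starX (s : GLf F) : Continuous (starX p s) :=
  continuous_rowMul (pMat p s 0 0) (pMat p s 0 1) (pMat p s 1 0) (pMat p s 1 1) (unitPart p s)

lemma extendX_add (φ ψ : C(S.X, OK K)) (η : Rp F p × Rp F p × Rp F p) :
    extendX S (φ + ψ) η = extendX S φ η + extendX S ψ η := by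
  by_cases h : InX η
  · simp only [extendX, h, dif_pos, ContinuousMap.add_apply]
  · simp only [extendX, h, dif_neg, not_false_eq_true, add_zero]

lemma extendX_smul (r : OK K) (φ : C(S.X, OK K)) (η : Rp F p × Rp F p × Rp F p) :
    extendX S (r • φ) η = r • extendX S φ η := by
  by_cases h : InX η
  · simp only [extendX, h, dif_pos, ContinuousMap.smul_apply]
  · simp only [extendX, h, dif_neg, not_false_eq_true, smul_zero]

/-- The function `η ↦ φ(η * s)` on `X`, with the value `0` at the `η` for which `η * s` does not
lie in `X`. -/
def pullFun [Fact p.Prime] (s : GLf F) (φ : C(S.X, OK K)) : C(S.X, OK K) :=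
  ⟨Quotient.lift (fun η => extendX S φ (starX p s η.1)) (by
      rintro η η' ⟨e, he, h⟩
      rw [h, starX_scale, extendX_scale S φ he]),
    Continuous.quotient_lift
      ((continuous_extendX S φ).comp ((continuous_starX s).comp continuous_subtype_val)) _⟩

/-- `φ ↦ (η ↦ φ(η * s))` as a linear map. -/
def pull [Fact p.Prime] (s : GLf F) : C(S.X, OK K) →ₗ[OK K] C(S.X, OK K) where
  toFun φ := pullFun S s φ
  map_add' φ ψ := by
    apply ContinuousMap.ext
    rintro ⟨η⟩
    exact extendX_add S φ ψ (starX p s η.1)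
  map_smul' r φ := by
    apply ContinuousMap.ext
    rintro ⟨η⟩
    exact extendX_smul S r φ (starX p s η.1)

lemma extendX_pull [Fact p.Prime] (s : GLf F) (φ : C(S.X, OK K)) {η : Rp F p × Rp F p × Rp F p}
    (h : InX η) : extendX S (pull S s φ) η = extendX S φ (starX p s η) := by
  simp only [extendX, h, dif_pos]
  rfl

variable (K) in
/-- The module `𝔻_X` of `𝒪`-valued measures on `X`, as the `𝒪`-dual of the space of continuous
functions `C(X, 𝒪)`. (An `𝒪`-linear functional `λ` is automatically continuous, since
`λ(p^n C(X, 𝒪)) ⊆ p^n 𝒪`.) -/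
abbrev Meas : Type _ := C(S.X, OK K) →ₗ[OK K] OK K

/-- The operation `μ ↦ μ * s` on `𝔻_X`:
`∫_X φ(η) d(μ * s)(η)` is the integral of `φ(η * s)` over the `η ∈ X` with `η * s ∈ X`. -/
def measAct [Fact p.Prime] (s : GLf F) : Meas S K →ₗ[OK K] Meas S K := LinearMap.lcomp _ _ (pull S s)

lemma measAct_apply [Fact p.Prime] (s : GLf F) (μ : Meas S K) (φ : C(S.X, OK K)) :
    measAct S s μ φ = μ (pull S s φ) := rfl

lemma measAct_compat [Fact p.Prime] {x : GLf F} (hx : x ∈ Delta0 (⊤ : Ideal (𝓞 F))) :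
    HeckeCompat S.S (measAct S (K := K)) x (measAct S) := by
  intro a ha b hb u hu
  have hs : a * x * b ∈ Delta0 (⊤ : Ideal (𝓞 F)) :=
    mul_mem (mul_mem (U0_le_Delta0 _ _ (S.le_U0_top ha)) hx) (U0_le_Delta0 _ _ (S.le_U0_top hb))
  have hu' := S.le_U0_top hu
  constructor
  · refine LinearMap.ext fun μ => LinearMap.ext fun φ => ?_
    rw [LinearMap.comp_apply, measAct_apply, measAct_apply, measAct_apply]
    congr 1
    apply ContinuousMap.ext
    rintro ⟨η⟩
    change extendX S φ (starX p _ η.1) = extendX S (pull S _ φ) (starX p u η.1)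
    rw [extendX_pull S _ φ ((inX_starX_unit hu' _).2 η.2), starX_unit_mul hs hu']
  · refine LinearMap.ext fun μ => LinearMap.ext fun φ => ?_
    rw [LinearMap.comp_apply, measAct_apply, measAct_apply, measAct_apply]
    congr 1
    apply ContinuousMap.ext
    rintro ⟨η⟩
    change extendX S φ (starX p _ η.1) = extendX S (pull S u φ) (starX p (a * x * b) η.1)
    rw [starX_mul_unit hs hu']
    by_cases h : InX (starX p (a * x * b) η.1)
    · rw [extendX_pull S _ φ h]
    · have h' : ¬ InX (starX p u (starX p (a * x * b) η.1)) := fun h2 =>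
        h ((inX_starX_unit hu' _).1 h2)
      simp only [extendX, h, h', dif_neg, not_false_eq_true]

end Measures

section Specialization

variable {F : Type*} [Field F] [NumberField F] {p : ℕ} [Fact p.Prime]
variable (S : TameLevel F p)
variable (K : Type*) [NormedField K] [IsUltrametricDist K] [CharZero K] [NormedAlgebra ℚ_[p] K]
  [FiniteDimensional ℚ_[p] K]

/-- The data of an arithmetic point `κ` that enter in its specialization map: a weight `(n, v)`
with `n ≥ 0` and `n + 2v = m t` parallel, an exponent `α ≥ 1`, and a character `ε` of
`(𝔯_p / p^α)^×` (extended by zero) such that `ε χ_cyc^m`, with `χ_cyc(z) = ∏_σ σ(z)`, factors through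
`𝔯_p^× / ē`. -/
structure ArithWeight where
  n : (F →+* K) → ℕ
  v : (F →+* K) → ℤ
  m : ℤ
  parallel : ∀ σ, (n σ : ℤ) + 2 * v σ = m
  α : ℕ
  one_le_α : 1 ≤ α
  ε : MulChar (Rp F p ⧸ Ideal.span {(p : Rp F p) ^ α}) (OK K)
  trivial_on_ebar : ∀ e ∈ S.ebar,
    ((ε (Ideal.Quotient.mk _ (e : Rp F p)) : OK K) : K) *
      ∏ σ : F →+* K, ((embO p σ (e : Rp F p) : OK K) : K) ^ m = 1

variable {S K}

namespace ArithWeight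

variable (κ : ArithWeight S K)

/-- The value `ε(x)`, for `x ∈ 𝔯_p`; it is zero if `x` is not a unit. -/
def eps (x : Rp F p) : OK K := κ.ε (Ideal.Quotient.mk _ x)

/-- `z^v = ∏_σ σ(z)^{v_σ}`, in `K`. -/
def powV (z : Rp F p) : K := ∏ σ : F →+* K, ((embO p σ z : OK K) : K) ^ κ.v σ

lemma powV_mul (z z' : Rp F p) : κ.powV (z * z') = κ.powV z * κ.powV z' := by
  simp only [powV, map_mul, Subring.coe_mul, mul_zpow, Finset.prod_mul_distrib]

lemma norm_powV {z : Rp F p} (hz : IsUnit z) : ‖κ.powV z‖ = 1 := by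
  simp [powV, norm_embO_unit p _ hz]

lemma eps_mul (x y : Rp F p) : κ.eps (x * y) = κ.eps x * κ.eps y := by
  simp [eps]

lemma eps_add {x y : Rp F p} (hy : y ∈ Ideal.span {(p : Rp F p) ^ κ.α}) :
    κ.eps (x + y) = κ.eps x := by
  rw [eps, map_add, Ideal.Quotient.eq_zero_iff_mem.2 hy, add_zero, eps]

/-- The weights of the variables: `X_σ` (the variable `(σ, 0)`) and `Y_σ` (the variable `(σ, 1)`)
have degree `1` in the coordinate `σ`. -/
def wt (i : (F →+* K) × Fin 2) : (F →+* K) → ℕ := open Classical in Pi.single i.1 1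

/-- The module `L(n, 𝒪)` of polynomials in the variables `X_σ` (the variable `(σ, 0)`) and `Y_σ`
(the variable `(σ, 1)`) over `𝒪` that are homogeneous of degree `n_σ` in `X_σ, Y_σ`. -/
abbrev L : Submodule (OK K) (MvPolynomial ((F →+* K) × Fin 2) (OK K)) :=
  weightedHomogeneousSubmodule (OK K) wt κ.n

/-- The substitution `P(X, Y) ↦ P((X, Y) M*)`, where `M* = (d, -b; -c, a)` for
`M = (a, b; c, d)`. -/
def subst (K : Type*) [NormedField K] [IsUltrametricDist K] [NormedAlgebra ℚ_[p] K]
    [FiniteDimensional ℚ_[p] K] (M : Matrix (Fin 2) (Fin 2) (Rp F p)) :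
    MvPolynomial ((F →+* K) × Fin 2) (OK K) →ₐ[OK K] MvPolynomial ((F →+* K) × Fin 2) (OK K) :=
  aeval fun i : (F →+* K) × Fin 2 =>
    ![C (embO p i.1 (M 1 1)) * X (i.1, 0) - C (embO p i.1 (M 1 0)) * X (i.1, 1),
      -C (embO p i.1 (M 0 1)) * X (i.1, 0) + C (embO p i.1 (M 0 0)) * X (i.1, 1)] i.2

lemma subst_mul (M N : Matrix (Fin 2) (Fin 2) (Rp F p)) :
    subst K (M * N) = (subst K N).comp (subst K M) := by
  refine MvPolynomial.algHom_ext fun ⟨σ, i⟩ => ?_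
  fin_cases i
  · simp [subst, Matrix.mul_apply, Fin.sum_univ_two]
    ring
  · simp [subst, Matrix.mul_apply, Fin.sum_univ_two]
    ring

lemma subst_X_homogeneous (M : Matrix (Fin 2) (Fin 2) (Rp F p)) (i : (F →+* K) × Fin 2) :
    IsWeightedHomogeneous wt (subst K M (X i)) (wt i) := by
  obtain ⟨σ, i⟩ := i
  have h0 : IsWeightedHomogeneous wt (X (σ, 0) : MvPolynomial ((F →+* K) × Fin 2) (OK K))
    (wt (σ, i)) := isWeightedHomogeneous_X (OK K) wt (σ, 0)
  have h1 : IsWeightedHomogeneous wt (X (σ, 1) : MvPolynomial ((F →+* K) × Fin 2) (OK K))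
    (wt (σ, i)) := isWeightedHomogeneous_X (OK K) wt (σ, 1)
  rw [subst, aeval_X]
  fin_cases i
  · exact (h0.C_mul _).sub (h1.C_mul _)
  · refine IsWeightedHomogeneous.add ?_ (h1.C_mul _)
    have h2 := h0.C_mul (-(embO p σ (M 0 1)))
    rw [map_neg] at h2
    exact h2

lemma subst_mem (M : Matrix (Fin 2) (Fin 2) (Rp F p))
    {P : MvPolynomial ((F →+* K) × Fin 2) (OK K)} (hP : P ∈ κ.L) : subst K M P ∈ κ.L := by
  rw [P.as_sum, map_sum]
  refine Submodule.sum_mem _ fun m hm => ?_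
  have hw : Finsupp.weight wt m = κ.n := hP (mem_support_iff.1 hm)
  rw [mem_weightedHomogeneousSubmodule, monomial_eq, map_mul, Finsupp.prod, map_prod, ← hw,
    Finsupp.weight_apply, Finsupp.sum, ← algebraMap_eq, AlgHom.commutes, algebraMap_eq]
  refine IsWeightedHomogeneous.C_mul (IsWeightedHomogeneous.prod _ _ _ fun i _ => ?_) _
  rw [map_pow]
  exact (subst_X_homogeneous M i).pow _

/-- The operation `t · P|_ε s` of `s` on `L(n, v, ε, 𝒪)` multiplied by `t ∈ K`:
`(t · P|_ε s)(X, Y) = t · ε(a) · det(s)^v · P((X, Y) s*)`, where `a` is the upper left entry of `s`.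
For `t = 1` this is the operation on `L(n, v, ε, 𝒪)`. -/
def slash (t : K) (s : GLf F) : κ.L →ₗ[OK K] κ.L :=
  (κ.eps (pMat p s 0 0) * toO (t * κ.powV (pMat p s).det)) •
    ((subst K (pMat p s)).toLinearMap.restrict fun _ hP => κ.subst_mem (pMat p s) hP)

lemma pMat_mem_span {F : Type*} [Field F] [NumberField F] {p : ℕ} {α : ℕ} {s : GLf F}
    (hs : s ∈ Delta0 (Ideal.span {(p : 𝓞 F) ^ α})) :
    pMat p s 1 0 ∈ Ideal.span {(p : Rp F p) ^ α} := by
  have h : ∀ w : PlaceAbove F p, (p : w.1.adicCompletionIntegers F) ^ α ∣ pMat p s 1 0 w := by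
    intro w
    obtain ⟨M, hM, hM'⟩ := hs w.1
    have : pMat p s 1 0 w = M 1 0 := by
      apply Subtype.ext
      rw [pMat_coe p (Delta0_mono le_top hs)]
      exact (congrFun (congrFun hM 1) 0).symm
    rw [this]
    rw [idealAt, Ideal.map_span, Set.image_singleton, Ideal.mem_span_singleton] at hM'
    simpa using hM'
  choose f hf using h
  exact Ideal.mem_span_singleton.2 ⟨f, funext hf⟩

lemma slash_apply (t : K) (s : GLf F) (P : κ.L) : ((κ.slash t s P : κ.L) :
    MvPolynomial ((F →+* K) × Fin 2) (OK K)) =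
      (κ.eps (pMat p s 0 0) * toO (t * κ.powV (pMat p s).det)) • subst K (pMat p s) P := rfl

lemma slash_compat {U : Subgroup (GLf F)} (hU : U ≤ U0 (Ideal.span {(p : 𝓞 F) ^ κ.α})) (t : K)
    {x : GLf F} (hx : x ∈ Delta0 (Ideal.span {(p : 𝓞 F) ^ κ.α})) :
    HeckeCompat (R := OK K) (E := κ.L) U (κ.slash 1) x (κ.slash t) := by
  intro a ha b hb u hu
  have hΔ : ∀ u ∈ U, u ∈ Delta0 (Ideal.span {(p : 𝓞 F) ^ κ.α}) := fun u hu =>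
    U0_le_Delta0 _ u (hU hu)
  have hs : a * x * b ∈ Delta0 (Ideal.span {(p : 𝓞 F) ^ κ.α}) :=
    mul_mem (mul_mem (hΔ a ha) hx) (hΔ b hb)
  have hs' := Delta0_mono le_top hs
  have hu' := Delta0_mono le_top (hΔ u hu)
  have hn : ‖κ.powV (pMat p u).det‖ = 1 := κ.norm_powV (isUnit_det_pMat p (U0_mono le_top (hU hu)))
  generalize a * x * b = s at hs hs' ⊢
  constructor
  · refine LinearMap.ext fun P => Subtype.ext ?_
    rw [LinearMap.comp_apply, slash_apply, slash_apply, slash_apply, pMat_mul p hu' hs', subst_mul,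
      Matrix.det_mul, powV_mul, one_mul, mul_comm (κ.powV _), ← mul_assoc,
      toO_mul_of_norm_eq_one _ _ hn, Matrix.mul_apply, Fin.sum_univ_two,
      κ.eps_add (Ideal.mul_mem_left _ _ (pMat_mem_span hs)), eps_mul, map_smul, smul_smul]
    congr 1
    ring
  · refine LinearMap.ext fun P => Subtype.ext ?_
    rw [LinearMap.comp_apply, slash_apply, slash_apply, slash_apply, pMat_mul p hs' hu', subst_mul,
      Matrix.det_mul, powV_mul, one_mul, ← mul_assoc,
      toO_mul_of_norm_eq_one _ _ hn, Matrix.mul_apply, Fin.sum_univ_two,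
      κ.eps_add (Ideal.mul_mem_left _ _ (pMat_mem_span (hΔ u hu))), eps_mul, map_smul, smul_smul]
    congr 1
    ring

lemma isOpen_span (α : ℕ) {F : Type*} [Field F] [NumberField F] {p : ℕ} [Fact p.Prime] :
    IsOpen ((Ideal.span {(p : Rp F p) ^ α} : Ideal (Rp F p)) : Set (Rp F p)) := by
  have := finite_placeAbove (F := F) (p := p)
  have hp : ∀ w : PlaceAbove F p, (p : w.1.adicCompletion F) ^ α ≠ 0 := fun w =>
    pow_ne_zero _ (by
      rw [← map_natCast (algebraMap F (w.1.adicCompletion F)), Ne, map_eq_zero]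
      exact_mod_cast (Fact.out : p.Prime).ne_zero)
  have h : ∀ w : PlaceAbove F p, IsOpen {y : Rp F p |
      Valued.v ((y w : w.1.adicCompletionIntegers F) : w.1.adicCompletion F) ≤
        Valued.v ((p : w.1.adicCompletion F) ^ α)} := by
    intro w
    have h1 := Valued.isOpen_closedBall (w.1.adicCompletion F) (Γ₀ := WithZero (Multiplicative ℤ))
      (r := Valued.v.restrict ((p : w.1.adicCompletion F) ^ α))
      ((Valuation.ne_zero_iff _).2 (hp w))
    have h2 := h1.preimage (f := fun y : Rp F p =>
      ((y w : w.1.adicCompletionIntegers F) : w.1.adicCompletion F))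
      (continuous_subtype_val.comp (continuous_apply w))
    convert h2 using 1
    ext y
    simp only [Set.mem_ofPred_eq, Set.mem_preimage, Valuation.restrict_le_iff]
  refine AddSubgroup.isOpen_of_mem_nhds
    (Ideal.span {(p : Rp F p) ^ α} : Ideal (Rp F p)).toAddSubgroup (g := 0)
    (Filter.mem_of_superset ((isOpen_iInter_of_finite h).mem_nhds (by simp)) ?_)
  intro y hy
  rw [Set.mem_iInter] at hy
  refine Ideal.mem_span_singleton.2 ⟨fun w => ⟨(y w : w.1.adicCompletion F) /
    (p : w.1.adicCompletion F) ^ α, ?_⟩, ?_⟩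
  · rw [mem_adicCompletionIntegers, map_div₀]
    exact div_le_one_of_le₀ (hy w) zero_le
  · funext w
    apply Subtype.ext
    simp only [Pi.mul_apply, Pi.pow_apply, MulMemClass.coe_mul, SubmonoidClass.coe_pow]
    exact (mul_div_cancel₀ _ (hp w)).symm

lemma continuous_eps : Continuous κ.eps := by
  rw [continuous_iff_continuousAt]
  intro x
  refine ContinuousAt.congr (f := fun _ => κ.eps x) continuousAt_const ?_
  have h : Continuous fun y : Rp F p => y - x := by fun_prop
  filter_upwards [((isOpen_span κ.α).preimage h).mem_nhds (by simp)] with y hy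
  rw [← κ.eps_add (x := x) hy, add_sub_cancel]

lemma continuous_powV : Continuous fun z : {z : Rp F p // IsUnit z} => toO (κ.powV z.1) := by
  have h : (fun z : {z : Rp F p // IsUnit z} => toO (κ.powV z.1)) =
      fun z => ⟨κ.powV z.1, (κ.norm_powV z.2).le⟩ := by
    funext z
    apply Subtype.ext
    rw [coe_toO (κ.norm_powV z.2).le]
  rw [h]
  refine Continuous.subtype_mk ?_ _
  refine continuous_finsetProd _ fun σ _ => Continuous.zpow₀ ?_ _ fun z => Or.inl ?_
  · exact continuous_subtype_val.comp ((continuous_embO p σ).comp continuous_subtype_val)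
  · exact norm_ne_zero_iff.1 (by rw [norm_embO_unit p σ z.2]; exact one_ne_zero)

/-- The polynomial `z^v ε(x) (xY - yX)^n`, as a function of `((x, y), z)`. It vanishes outside
of `X'`, since `ε(x) = 0` if `x` is not a unit. -/
def kerPoly (η : Rp F p × Rp F p × Rp F p) : MvPolynomial ((F →+* K) × Fin 2) (OK K) :=
  (toO (κ.powV η.2.2) * κ.eps η.1) •
    ∏ σ : F →+* K,
      (C (embO p σ η.1) * X (σ, 1) - C (embO p σ η.2.1) * X (σ, 0)) ^ κ.n σ

lemma weight_wt (m : (F →+* K) × Fin 2 →₀ ℕ) (i : (F →+* K) × Fin 2) :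
    m i ≤ Finsupp.weight wt m i.1 := by
  classical
  rw [Finsupp.weight_apply, Finsupp.sum_fintype _ _ (by simp), Finset.sum_apply]
  refine le_trans ?_ (Finset.single_le_sum (f := fun j => (m j • wt j) i.1) (fun _ _ => zero_le)
    (Finset.mem_univ i))
  simp [wt]

lemma kerPoly_mem (η : Rp F p × Rp F p × Rp F p) : κ.kerPoly η ∈ κ.L := by
  classical
  refine Submodule.smul_mem _ _ ?_
  rw [mem_weightedHomogeneousSubmodule]
  have hn : κ.n = ∑ σ : F →+* K, κ.n σ • wt (σ, 0) := by
    funext τ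
    simp [wt, Finset.sum_apply, Pi.single_apply]
  rw [hn]
  refine IsWeightedHomogeneous.prod _ _ _ fun σ _ => ?_
  simp only [← hn]
  refine IsWeightedHomogeneous.pow (IsWeightedHomogeneous.sub ?_ ?_) _
  · exact (isWeightedHomogeneous_X (OK K) wt (σ, 1)).C_mul _
  · exact (isWeightedHomogeneous_X (OK K) wt (σ, 0)).C_mul _

/-- The family of polynomials depends continuously on the parameter. -/
def PolyCont {T : Type*} [TopologicalSpace T]
    (P : T → MvPolynomial ((F →+* K) × Fin 2) (OK K)) : Prop :=
  ∀ m, Continuous fun t => coeff m (P t)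

lemma PolyCont.mul {T : Type*} [TopologicalSpace T]
    {P Q : T → MvPolynomial ((F →+* K) × Fin 2) (OK K)} (hP : PolyCont P) (hQ : PolyCont Q) :
    PolyCont fun t => P t * Q t := by
  classical
  intro m
  simp only [coeff_mul]
  exact continuous_finsetSum _ fun i _ => (hP _).mul (hQ _)

lemma PolyCont.sub {T : Type*} [TopologicalSpace T]
    {P Q : T → MvPolynomial ((F →+* K) × Fin 2) (OK K)} (hP : PolyCont P) (hQ : PolyCont Q) :
    PolyCont fun t => P t - Q t := by
  intro m
  simp only [coeff_sub]
  exact (hP _).sub (hQ _)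

lemma PolyCont.const {T : Type*} [TopologicalSpace T]
    (P : MvPolynomial ((F →+* K) × Fin 2) (OK K)) : PolyCont fun _ : T => P :=
  fun _ => continuous_const

lemma PolyCont.C {T : Type*} [TopologicalSpace T] {f : T → OK K} (hf : Continuous f) :
    PolyCont (F := F) fun t => MvPolynomial.C (f t) := by
  classical
  intro m
  simp only [coeff_C]
  split_ifs
  · exact hf
  · exact continuous_const

lemma PolyCont.pow {T : Type*} [TopologicalSpace T]
    {P : T → MvPolynomial ((F →+* K) × Fin 2) (OK K)} (hP : PolyCont P) (k : ℕ) :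
    PolyCont fun t => P t ^ k := by
  induction k with
  | zero => simpa using PolyCont.const 1
  | succ k ih => simpa only [pow_succ] using ih.mul hP

lemma PolyCont.prod {T ι : Type*} [TopologicalSpace T]
    {P : ι → T → MvPolynomial ((F →+* K) × Fin 2) (OK K)} (s : Finset ι)
    (hP : ∀ i, PolyCont (P i)) :
    PolyCont fun t => ∏ i ∈ s, P i t := by
  classical
  induction s using Finset.induction_on with
  | empty => simpa using PolyCont.const 1
  | insert a s ha ih => simpa only [Finset.prod_insert ha] using (hP a).mul ih

lemma kerPoly_cont : PolyCont fun η : {η : Rp F p × Rp F p × Rp F p // InX η} => κ.kerPoly η.1 := by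
  simp only [kerPoly, smul_eq_C_mul]
  have h1 : Continuous fun η : {η : Rp F p × Rp F p × Rp F p // InX η} => η.1.1 := by fun_prop
  have h2 : Continuous fun η : {η : Rp F p × Rp F p × Rp F p // InX η} => η.1.2.1 := by fun_prop
  have h3 : Continuous fun η : {η : Rp F p × Rp F p × Rp F p // InX η} =>
      (⟨η.1.2.2, η.2.2⟩ : {z : Rp F p // IsUnit z}) := by fun_prop
  refine PolyCont.mul (PolyCont.C ((κ.continuous_powV.comp h3).mul (κ.continuous_eps.comp h1)))
    (PolyCont.prod _ fun σ => PolyCont.pow (PolyCont.sub ?_ ?_) _)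
  · exact (PolyCont.C ((continuous_embO p σ).comp h1)).mul (PolyCont.const _)
  · exact (PolyCont.C ((continuous_embO p σ).comp h2)).mul (PolyCont.const _)

lemma kerPoly_scale {e : (Rp F p)ˣ} (he : e ∈ S.ebar) {η : Rp F p × Rp F p × Rp F p}
    (hη : InX η) : κ.kerPoly (scaleX (e : Rp F p) η) = κ.kerPoly η := by
  have hprod : ∏ σ : F →+* K, (C (embO p σ (scaleX (e : Rp F p) η).1) * X (σ, 1) -
        C (embO p σ (scaleX (e : Rp F p) η).2.1) * X (σ, 0)) ^ κ.n σ =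
      (∏ σ : F →+* K, embO p σ (e : Rp F p) ^ κ.n σ) •
      ∏ σ : F →+* K,
        (C (embO p σ η.1) * X (σ, 1) - C (embO p σ η.2.1) * X (σ, 0) :
          MvPolynomial ((F →+* K) × Fin 2) (OK K)) ^ κ.n σ := by
    rw [smul_eq_C_mul, map_prod, ← Finset.prod_mul_distrib]
    refine Finset.prod_congr rfl fun σ _ => ?_
    rw [map_pow, ← mul_pow]
    congr 1
    simp only [scaleX, map_mul]
    ring
  rw [kerPoly, kerPoly, hprod, smul_smul]
  congr 1
  have hu : ∀ σ : F →+* K, ((embO p σ (e : Rp F p) : OK K) : K) ≠ 0 := fun σ =>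
    norm_ne_zero_iff.1 (by rw [norm_embO_unit p σ e.isUnit]; exact one_ne_zero)
  have hz : ‖κ.powV η.2.2‖ ≤ 1 := (κ.norm_powV hη.2).le
  have hz' : ‖κ.powV (scaleX (e : Rp F p) η).2.2‖ ≤ 1 :=
    (κ.norm_powV ((inX_scale e η).2 hη).2).le
  apply Subtype.ext
  have ht := κ.trivial_on_ebar e he
  simp only [Subring.coe_mul, coe_toO hz, coe_toO hz']
  have e1 : (scaleX (e : Rp F p) η).1 = e * η.1 := rfl
  have e2 : (scaleX (e : Rp F p) η).2.2 = (e * e) * η.2.2 := by rw [← pow_two]; rfl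
  have e3 : (((∏ σ : F →+* K, embO p σ (e : Rp F p) ^ κ.n σ) : OK K) : K) * κ.powV (e * e) =
      ∏ σ : F →+* K, ((embO p σ (e : Rp F p) : OK K) : K) ^ κ.m := by
    rw [powV_mul, powV, ← Finset.prod_mul_distrib]
    push_cast
    rw [← Finset.prod_mul_distrib]
    refine Finset.prod_congr rfl fun σ _ => ?_
    rw [← zpow_natCast, ← zpow_add₀ (hu σ), ← zpow_add₀ (hu σ), ← κ.parallel σ, two_mul]
  rw [e1, e2, powV_mul, eps_mul, Subring.coe_mul]
  have ht' : ((κ.eps (e : Rp F p) : OK K) : K) *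
    ((((∏ σ : F →+* K, embO p σ (e : Rp F p) ^ κ.n σ) : OK K) : K) * κ.powV (e * e)) = 1 := by
    rw [e3]; exact ht
  linear_combination (κ.powV η.2.2 * ((κ.eps η.1 : OK K) : K)) * ht'

/-- The coefficient of the monomial `m` of `z^v ε(x) (xY - yX)^n`, as a continuous function
on `X`. -/
def coeffX (m : (F →+* K) × Fin 2 →₀ ℕ) : C(S.X, OK K) :=
  ⟨Quotient.lift (fun η => coeff m (κ.kerPoly η.1)) (by
      rintro η η' ⟨e, he, h⟩
      rw [h, κ.kerPoly_scale he η.2]),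
    Continuous.quotient_lift (κ.kerPoly_cont m) _⟩

lemma coeffX_eq_zero {m : (F →+* K) × Fin 2 →₀ ℕ} (hm : Finsupp.weight wt m ≠ κ.n) :
    κ.coeffX m = 0 := by
  apply ContinuousMap.ext
  rintro ⟨η⟩
  exact IsWeightedHomogeneous.coeff_eq_zero (κ.kerPoly_mem η.1) m hm

lemma finite_monos : {m : (F →+* K) × Fin 2 →₀ ℕ | Finsupp.weight wt m = κ.n}.Finite := by
  classical
  refine (Set.finite_Icc (0 : (F →+* K) × Fin 2 →₀ ℕ)
    (Finsupp.equivFunOnFinite.symm fun i => κ.n i.1)).subset fun m hm => ⟨zero_le, fun i => ?_⟩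
  change m i ≤ κ.n i.1
  rw [← hm]
  exact weight_wt m i

/-- The monomials of degree `n_σ` in `X_σ, Y_σ`. -/
def monos : Finset ((F →+* K) × Fin 2 →₀ ℕ) := κ.finite_monos.toFinset

lemma mem_monos {m : (F →+* K) × Fin 2 →₀ ℕ} : m ∈ κ.monos ↔ Finsupp.weight wt m = κ.n := by
  simp [monos]

/-- The specialization map `ρ_κ(μ) = ∫_{X'} z^v ε(x) (xY - yX)^n dμ(x, y, z)`, the integral being
taken coefficient by coefficient. -/
def rho : Meas S K →ₗ[OK K] κ.L where
  toFun μ := ⟨∑ m ∈ κ.monos, monomial m (μ (κ.coeffX m)), by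
    exact Submodule.sum_mem _ fun m hm =>
      isWeightedHomogeneous_monomial _ _ _ (κ.mem_monos.1 hm)⟩
  map_add' μ ν := by
    apply Subtype.ext
    simp [Finset.sum_add_distrib]
  map_smul' r μ := by
    apply Subtype.ext
    simp [Finset.smul_sum, smul_monomial]

lemma kerPoly_star {u : GLf F} (hu : u ∈ U0 (Ideal.span {(p : 𝓞 F) ^ κ.α}))
    (η : Rp F p × Rp F p × Rp F p) :
    κ.kerPoly (starX p u η) = (κ.eps (pMat p u 0 0) * toO (1 * κ.powV (pMat p u).det)) •
      subst K (pMat p u) (κ.kerPoly η) := by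
  have hu' := U0_mono le_top hu
  have hn : ‖κ.powV (pMat p u).det‖ = 1 := κ.norm_powV (isUnit_det_pMat p hu')
  rw [kerPoly, kerPoly, map_smul, smul_smul, map_prod]
  congr 1
  · simp only [starX, unitPart_unit hu', powV_mul, one_mul]
    rw [toO_mul_of_norm_eq_one _ _ hn,
      κ.eps_add (Ideal.mul_mem_left _ _ (pMat_mem_span (U0_le_Delta0 _ u hu))), eps_mul]
    ring
  · refine Finset.prod_congr rfl fun σ _ => ?_
    rw [map_pow]
    congr 1
    simp [starX, subst]
    ring

lemma rho_coe (μ : Meas S K) : ((κ.rho μ : κ.L) : MvPolynomial ((F →+* K) × Fin 2) (OK K)) =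
    ∑ m ∈ κ.monos, monomial m (μ (κ.coeffX m)) := rfl

lemma coeff_rho (μ : Meas S K) (m : (F →+* K) × Fin 2 →₀ ℕ) :
    coeff m ((κ.rho μ : κ.L) : MvPolynomial ((F →+* K) × Fin 2) (OK K)) = μ (κ.coeffX m) := by
  classical
  rw [rho_coe, coeff_sum]
  simp only [coeff_monomial, Finset.sum_ite_eq', mem_monos]
  split_ifs with h
  · rfl
  · rw [κ.coeffX_eq_zero h, map_zero]

lemma kerPoly_sum (η : Rp F p × Rp F p × Rp F p) : κ.kerPoly η =
    ∑ m ∈ κ.monos, monomial m (coeff m (κ.kerPoly η)) := by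
  classical
  refine MvPolynomial.ext _ _ fun m => ?_
  rw [coeff_sum]
  simp only [coeff_monomial, Finset.sum_ite_eq', mem_monos]
  split_ifs with h
  · rfl
  · exact IsWeightedHomogeneous.coeff_eq_zero (κ.kerPoly_mem η) m h

lemma sum_smul_apply {K T ι : Type*} [NormedField K] [IsUltrametricDist K] [TopologicalSpace T]
    (s : Finset ι) (r : ι → OK K) (f : ι → C(T, OK K)) (q : T) :
    (∑ i ∈ s, r i • f i) q = ∑ i ∈ s, r i * f i q := by
  simp

/-- The specialization map is equivariant. -/
lemma rho_equivariant {u : GLf F} (hu : u ∈ U0 (Ideal.span {(p : 𝓞 F) ^ κ.α})) (μ : Meas S K) :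
    κ.rho (measAct S u μ) = κ.slash 1 u (κ.rho μ) := by
  apply Subtype.ext
  refine MvPolynomial.ext _ _ fun m => ?_
  rw [coeff_rho, slash_apply, coeff_smul, rho_coe, measAct_apply, map_sum, coeff_sum]
  have key : pull S u (κ.coeffX m) = ∑ m' ∈ κ.monos,
      ((κ.eps (pMat p u 0 0) * toO (1 * κ.powV (pMat p u).det)) *
        coeff m (subst K (pMat p u) (monomial m' 1))) • κ.coeffX m' := by
    apply ContinuousMap.ext
    rintro ⟨η⟩
    have hη : InX (starX p u η.1) := (inX_starX_unit (U0_mono le_top hu) _).2 η.2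
    have h1 : pull S u (κ.coeffX m) (Quot.mk _ η) = coeff m (κ.kerPoly (starX p u η.1)) := by
      change extendX S (κ.coeffX m) (starX p u η.1) = _
      simp only [extendX, hη, dif_pos]
      rfl
    have h2 : ∀ m', κ.coeffX m' (Quot.mk _ η) = coeff m' (κ.kerPoly η.1) := fun m' => rfl
    rw [h1, κ.kerPoly_star hu η.1, coeff_smul, κ.kerPoly_sum η.1, map_sum, coeff_sum,
      Finset.smul_sum]
    refine Eq.trans ?_ (sum_smul_apply _ _ _ _).symm
    refine Finset.sum_congr rfl fun m' _ => ?_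
    rw [h2, ← mul_one (coeff m' (κ.kerPoly η.1)),
      ← smul_eq_mul (coeff m' (κ.kerPoly η.1)), ← smul_monomial, map_smul, coeff_smul]
    simp only [smul_eq_mul]
    ring
  rw [key, map_sum, Finset.smul_sum]
  refine Finset.sum_congr rfl fun m' _ => ?_
  rw [map_smul, ← mul_one (μ (κ.coeffX m')), ← smul_eq_mul (μ (κ.coeffX m')), ← smul_monomial,
    map_smul, coeff_smul]
  simp only [smul_eq_mul]
  ring

end ArithWeight

end Specialization

section ModularSymbols

variable {F : Type*} [Field F] [NumberField F] {p : ℕ} [Fact p.Prime]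
variable (S : TameLevel F p)
variable (K : Type*) [NormedField K] [IsUltrametricDist K] [CharZero K] [NormedAlgebra ℚ_[p] K]
  [FiniteDimensional ℚ_[p] K]

/-- The matrix `(1, 0; 0, q)`, for an idele `q`. -/
def diagOne (q : (FiniteAdeleRing (𝓞 F) F)ˣ) : GLf F where
  val := !![1, 0; 0, (q : FiniteAdeleRing (𝓞 F) F)]
  inv := !![1, 0; 0, ((q⁻¹ : (FiniteAdeleRing (𝓞 F) F)ˣ) : FiniteAdeleRing (𝓞 F) F)]
  val_inv := by simp [Matrix.one_fin_two]
  inv_val := by simp [Matrix.one_fin_two]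

/-- The idele `q` is integral at all the finite places. -/
def IsIntegralIdele (q : (FiniteAdeleRing (𝓞 F) F)ˣ) : Prop :=
  ∀ w : HeightOneSpectrum (𝓞 F), (q : FiniteAdeleRing (𝓞 F) F) w ∈ w.adicCompletionIntegers F

lemma diagOne_mem {q : (FiniteAdeleRing (𝓞 F) F)ˣ} (hq : IsIntegralIdele q) (𝔪 : Ideal (𝓞 F)) :
    diagOne q ∈ Delta0 𝔪 := by
  intro w
  refine ⟨!![1, 0; 0, ⟨_, hq w⟩], ?_, by simp⟩
  ext i j
  fin_cases i <;> fin_cases j <;> rfl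

/-- `q` is an idele that generates `𝔮` at the prime `𝔮`, with component `1` at the other primes. -/
def IsPrimeIdele (𝔮 : HeightOneSpectrum (𝓞 F)) (q : (FiniteAdeleRing (𝓞 F) F)ˣ) : Prop :=
  Valued.v ((q : FiniteAdeleRing (𝓞 F) F) 𝔮) = WithZero.exp (-1 : ℤ) ∧
    ∀ w, w ≠ 𝔮 → (q : FiniteAdeleRing (𝓞 F) F) w = 1

lemma IsPrimeIdele.isIntegral {F : Type*} [Field F] [NumberField F] {𝔮 : HeightOneSpectrum (𝓞 F)}
    {q : (FiniteAdeleRing (𝓞 F) F)ˣ} (h : IsPrimeIdele 𝔮 q) : IsIntegralIdele q := by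
  intro w
  by_cases hw : w = 𝔮
  · subst hw
    rw [mem_adicCompletionIntegers, h.1, ← WithZero.exp_zero, WithZero.exp_le_exp]
    norm_num
  · rw [h.2 w hw]
    exact one_mem _

variable (p) in
/-- `ϖ` is the idele with component `p` at the primes above `p` and `1` at the other primes. -/
def IsPIdele (ϖ : (FiniteAdeleRing (𝓞 F) F)ˣ) : Prop :=
  (∀ w : HeightOneSpectrum (𝓞 F), (p : 𝓞 F) ∈ w.asIdeal →
    (ϖ : FiniteAdeleRing (𝓞 F) F) w = (p : w.adicCompletion F)) ∧
  ∀ w : HeightOneSpectrum (𝓞 F), (p : 𝓞 F) ∉ w.asIdeal → (ϖ : FiniteAdeleRing (𝓞 F) F) w = 1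

lemma IsPIdele.isIntegral {F : Type*} [Field F] [NumberField F] {p : ℕ}
    {ϖ : (FiniteAdeleRing (𝓞 F) F)ˣ} (h : IsPIdele p ϖ) : IsIntegralIdele ϖ := by
  intro w
  by_cases hw : (p : 𝓞 F) ∈ w.asIdeal
  · rw [h.1 w hw]
    exact natCast_mem _ p
  · rw [h.2 w hw]
    exact one_mem _

/-- The module `𝕎 = H^d_cpt(X_S, 𝒟_X)` of `Λ`-adic modular symbols, where `d = [F : ℚ]`. -/
abbrev LambdaSymbols : Type _ :=
  Hcpt (R := OK K) (E := Meas S K) S.S (measAct S) (Module.finrank ℚ F)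

/-- The Hecke operator `Φ ↦ Φ * T(x)` on `𝕎`, for an integral matrix `x`. -/
def LambdaSymbols.T (x : GLf F) (hx : x ∈ Delta0 (⊤ : Ideal (𝓞 F))) :
    LambdaSymbols S K →ₗ[OK K] LambdaSymbols S K :=
  hecke S.isOpen S.isCompact x (measAct S) (measAct_compat S hx) (Module.finrank ℚ F)

variable {S K}

/-- A level of the weight `κ`: an open subgroup `U` with `S(p^α) ⊆ U ⊆ S₀(p^α)`. -/
structure ArithWeight.Level (κ : ArithWeight S K) where
  U : Subgroup (GLf F)
  isOpen : IsOpen (U : Set (GLf F))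
  ge : S.S ⊓ Ufull (Ideal.span {(p : 𝓞 F) ^ κ.α}) ≤ U
  le : U ≤ S.S ⊓ U0 (Ideal.span {(p : 𝓞 F) ^ κ.α})

namespace ArithWeight.Level

variable {κ : ArithWeight S K} (V : κ.Level)

lemma le_S : V.U ≤ S.S := V.le.trans inf_le_left

lemma le_U0 : V.U ≤ U0 (Ideal.span {(p : 𝓞 F) ^ κ.α}) := V.le.trans inf_le_right

lemma isCompact : IsCompact (V.U : Set (GLf F)) :=
  S.isCompact.of_isClosed_subset (V.U.isClosed_of_isOpen V.isOpen) V.le_S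

/-- The module `𝕎_κ = H^d_cpt(X_U, ℒ(n, v, ε, 𝒪))` of classical modular symbols. -/
abbrev Symbols : Type _ :=
  Hcpt (R := OK K) (E := κ.L) V.U (κ.slash 1) (Module.finrank ℚ F)

/-- The Hecke operator `t · T(x)` on `𝕎_κ`, for `x ∈ Δ₀(p^α)` and a scalar `t ∈ K`. The scalar is
multiplied with the operation of the double coset of `x` on `L(n, v, ε, K)`, so that the operator is
defined as soon as `t · P|_ε s` has coefficients in `𝒪` for `P ∈ L(n, v, ε, 𝒪)` and `s ∈ U x U`. -/
def scaledT (t : K) (x : GLf F) (hx : x ∈ Delta0 (Ideal.span {(p : 𝓞 F) ^ κ.α})) :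
    V.Symbols →ₗ[OK K] V.Symbols :=
  hecke V.isOpen V.isCompact x (κ.slash t) (κ.slash_compat V.le_U0 t hx) (Module.finrank ℚ F)

/-- The Hecke operator `T(x)` on `𝕎_κ`. -/
def T (x : GLf F) (hx : x ∈ Delta0 (Ideal.span {(p : 𝓞 F) ^ κ.α})) :
    V.Symbols →ₗ[OK K] V.Symbols :=
  V.scaledT 1 x hx

/-- The normalized Hecke operator `T₀(p) = ({p}^v)⁻¹ T(p)` on `𝕎_κ`, where
`T(p) = T((1, 0; 0, ϖ))` and `{p}^v = ∏_σ p^{v_σ}`. -/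
def T0 (ϖ : (FiniteAdeleRing (𝓞 F) F)ˣ) (hϖ : IsPIdele p ϖ) : V.Symbols →ₗ[OK K] V.Symbols :=
  V.scaledT (∏ σ : F →+* K, (p : K) ^ κ.v σ)⁻¹ (diagOne ϖ) (diagOne_mem hϖ.isIntegral _)

/-- The specialization map on cochains, with the restriction from `X_S` to `X_U`. -/
def rhoCochain (k : ℕ) :
    Cochain (R := OK K) (E := Meas S K) S.S (measAct S) k →ₗ[OK K]
      Cochain (R := OK K) (E := κ.L) V.U (κ.slash 1) k :=
  pushCochain (R := OK K) (E := Meas S K) (E' := κ.L) V.le_S S.isCompact κ.rho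
    (fun _ hu μ => κ.rho_equivariant (V.le_U0 hu) μ) k

lemma rhoCochain_coboundary (k : ℕ)
    (c : Cochain (R := OK K) (E := Meas S K) S.S (measAct S) k) :
    V.rhoCochain (k + 1) (coboundary (R := OK K) (E := Meas S K) S.S (measAct S) k c) =
      coboundary (R := OK K) (E := κ.L) V.U (κ.slash 1) k (V.rhoCochain k c) := by
  apply Subtype.ext; funext g τ
  change κ.rho (∑ i : Fin (k + 2), (-1 : OK K) ^ (i : ℕ) • c.1 g (face i τ)) =
    ∑ i : Fin (k + 2), (-1 : OK K) ^ (i : ℕ) • κ.rho (c.1 g (face i τ))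
  simp only [map_sum, map_smul]

/-- The specialization map `ρ_κ : 𝕎 → 𝕎_κ`. -/
def rho : LambdaSymbols S K →ₗ[OK K] V.Symbols :=
  Hcpt.map (R := OK K) (E := Meas S K) (E' := κ.L) V.rhoCochain V.rhoCochain_coboundary
    (Module.finrank ℚ F)

end ArithWeight.Level

end ModularSymbols

end HilbertSymbols

end

open HilbertSymbols

/-! Write `x` for the matrix of the Hecke operator. The operator on `𝕎` is a sum over the cosets in
`S \ S x S`, the one on `𝕎_κ` a sum over `U \ U x U`, with `U ≤ S`. The two are compared term by
term on cochains, which rests on three facts.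

Equivariance. Under `η ↦ η * s` the linear form `xY - yX` undergoes exactly the substitution `(X, Y)
↦ (X, Y) s*`. If the lower left entry `c` of `s` is divisible by `p^α`, then `ε(xa + yc) = ε(x)
ε(a)`. The remaining factor is `δ(s)^v` where the slash operation has `det(s)^v`; the quotient of
the two is a scalar `t`, equal to `1` when `x` is trivial at `p`, and to `({p}^v)⁻¹` for `T(p)`.
Hence `ρ_κ(μ * s) = t · ρ_κ(μ)|_ε s` for `s ∈ U x U` (`ArithWeight.rho_measAct`). This explains why
`T₀(p)`, and not `T(p)`, occurs on the classical side. Points that leave `X` cause no loss: their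
first coordinate is a non-unit at some `w ∣ p`, and `ε` vanishes there.

Injectivity. The map `U \ U x U → S \ S x S` is injective as soon as `x u x⁻¹ ∈ S` forces `x u x⁻¹ ∈
U` for `u ∈ U` (`cosetMap_injOn`). Since `U` contains `S ∩ U(p^α)`, it is enough that `x u x⁻¹ u⁻¹`
is unipotent modulo `p^α`. This is trivial if `x_p = 1`, and is a computation with `(1, 0; 0, p)`
otherwise (`mul_inv_mem_localGamma`).

Vanishing. For `𝔮 ∤ p` every coset of `S x S` comes from `U x U`. At `p`, a coset `S x k` comes from
`U x U` when the upper left entry of `k` is a unit at all `w ∣ p`, because it is then represented by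
a unipotent matrix there (`exists_mul_diag_unipotent`). If that entry is a non-unit at some `w`, the
first column of `x k` lies in the maximal ideal at `w`; so does the first coordinate of every `η *
s`, and `ε` kills the integrand (`ArithWeight.rho_measAct_eq_zero`).

`heckeFun_comp` combines these facts formally, and `ArithWeight.Level.rho_T_eq_scaledT` applies it
to `ρ_κ`. -/

namespace HilbertSymbols

/-! ### Comparison of Hecke operators for two levels `U' ≤ U`. -/

section Cohomology

variable {F : Type*} [Field F] [NumberField F] {R : Type*} [CommRing R]
  {E : Type*} [AddCommGroup E] [Module R E] {E' : Type*} [AddCommGroup E'] [Module R E']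
  {U U' : Subgroup (GLf F)} {act : GLf F → E →ₗ[R] E} {act' : GLf F → E' →ₗ[R] E'}

/-- The map `U' \ G → U \ G` for subgroups `U' ≤ U`. -/
def cosetMap {G : Type*} [Group G] {U U' : Subgroup G} (hU : U' ≤ U)
    (q : Quotient (QuotientGroup.rightRel U')) : Quotient (QuotientGroup.rightRel U) :=
  Quotient.map' id (fun s s' h => by
    rw [QuotientGroup.rightRel_apply] at h ⊢
    exact hU h) q

lemma cosetMap_mk {G : Type*} [Group G] {U U' : Subgroup G} (hU : U' ≤ U) (s : G) :
    cosetMap hU (Quotient.mk (QuotientGroup.rightRel U') s) = Quotient.mk _ s := rfl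

/-- Two cosets of `x u` and `x v` agree over a subgroup exactly when it contains `x (v u⁻¹) x⁻¹`,
and `hx` transfers this membership from `U` to `U'`. -/
lemma cosetMap_injOn {G : Type*} [Group G] {U U' : Subgroup G} (hU : U' ≤ U) {x : G}
    (hx : ∀ u ∈ U', x * u * x⁻¹ ∈ U → x * u * x⁻¹ ∈ U') :
    Set.InjOn (cosetMap hU) (doubleCosets U' x) := by
  rintro _ ⟨u, hu, rfl⟩ _ ⟨v, hv, rfl⟩ h
  rw [cosetMap_mk, cosetMap_mk] at h
  have h := QuotientGroup.rightRel_apply.1 (Quotient.exact h)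
  have e : x * v * (x * u)⁻¹ = x * (v * u⁻¹) * x⁻¹ := by group
  refine Quotient.sound (QuotientGroup.rightRel_apply.2 ?_)
  rw [e] at h ⊢
  exact hx _ (U'.mul_mem hv (U'.inv_mem hu)) h

/-- An equivariant map of coefficients commutes with the Hecke operators of `x` for `U` and
`U' ≤ U`, if the cosets in `U' \ U' x U'` stay distinct in `U \ U x U` and the map annihilates the
terms of the remaining cosets. -/
lemma heckeFun_comp (hU : U' ≤ U) (hUo : IsOpen (U : Set (GLf F)))
    (hUc : IsCompact (U : Set (GLf F))) {x : GLf F}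
    {op : GLf F → E →ₗ[R] E} (hop : HeckeCompat U act x op) {op' : GLf F → E' →ₗ[R] E'}
    (f : E →ₗ[R] E')
    (hinj : ∀ u ∈ U', x * u * x⁻¹ ∈ U → x * u * x⁻¹ ∈ U')
    (hcomm : ∀ a ∈ U', ∀ b ∈ U', ∀ e, f (op (a * x * b) e) = op' (a * x * b) (f e))
    (hzero : ∀ k ∈ U, (∃ u ∈ U', x * k * (x * u)⁻¹ ∈ U) ∨ ∀ a ∈ U, ∀ e, f (op (a * x * k) e) = 0)
    {k : ℕ} (c : Cochain U act k) (g : GLf F) (τ : Simplex F k) :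
    f (heckeFun U x op c.1 g τ) =
      heckeFun U' x op' (k := k) (fun g τ => f (c.1 g τ)) g τ := by
  have hfin := finite_doubleCosets hUo hUc x
  have himg : cosetMap hU '' doubleCosets U' x ⊆ doubleCosets U x := by
    rintro _ ⟨_, ⟨u, hu, rfl⟩, rfl⟩
    exact ⟨u, hU hu, rfl⟩
  have h1 : ∑ᶠ q ∈ doubleCosets U x, f (op q.out (c.1 (g * q.out⁻¹) τ)) =
      ∑ᶠ q ∈ cosetMap hU '' doubleCosets U' x, f (op q.out (c.1 (g * q.out⁻¹) τ)) := by
    -- Only cosets with a nonzero term matter, so it suffices that such a coset lies in the image;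
    -- `hzero` gives this or a contradiction.
    refine finsum_mem_inter_support_eq' _ _ _ fun q hq => ⟨fun hq' => ?_, fun hq' => himg hq'⟩
    obtain ⟨k, hk, rfl⟩ := hq'
    rcases hzero k hk with ⟨u, hu, h⟩ | h
    · exact ⟨_, ⟨u, hu, rfl⟩, Quotient.sound (QuotientGroup.rightRel_apply.2 h)⟩
    · refine absurd ?_ hq
      have hs := QuotientGroup.rightRel_apply.1
        (Quotient.mk_out (s := QuotientGroup.rightRel U) (x * k))
      -- The chosen representative of the coset of `x k` has the form `a * x * k` with `a ∈ U`. The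
      -- vanishing is therefore required for all left factors in `U`.
      have := h _ (U.inv_mem hs)
      rw [show (x * k * (Quotient.mk (QuotientGroup.rightRel U) (x * k)).out⁻¹)⁻¹ * x * k =
        (Quotient.mk (QuotientGroup.rightRel U) (x * k)).out by group] at this
      exact this _
  have h2 : f (heckeFun U x op c.1 g τ) =
      ∑ᶠ q ∈ doubleCosets U x, f (op q.out (c.1 (g * q.out⁻¹) τ)) :=
    f.toAddMonoidHom.map_finsum_mem _ hfin
  rw [h2, h1]
  refine (finsum_mem_eq_of_bijOn (cosetMap hU) (cosetMap_injOn hU hinj).bijOn_image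
    fun q hq => ?_).symm
  obtain ⟨a, ha, b, hb, hab⟩ := out_mem hq
  -- The representatives chosen for a `U'`-coset and for its image may differ. As the term over `U`
  -- depends only on the coset, it can be computed with the representative from `U' x U'`, where
  -- `hcomm` is available.
  have hmk : Quotient.mk (QuotientGroup.rightRel U) q.out = Quotient.mk _ (cosetMap hU q).out := by
    rw [Quotient.out_eq, ← cosetMap_mk hU, Quotient.out_eq]
  rw [heckeTerm_eq hop c g τ ⟨a, hU ha, b, hU hb, hab⟩ hmk, hab, hcomm a ha b hb]

/-- Commuting maps of complexes induce commuting maps in cohomology. -/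
lemma Hcpt.map_comm (f : ∀ k, Cochain U act k →ₗ[R] Cochain U' act' k)
    (hf : ∀ k c, f (k + 1) (coboundary U act k c) = coboundary U' act' k (f k c))
    (T : ∀ k, Cochain U act k →ₗ[R] Cochain U act k)
    (hT : ∀ k c, T (k + 1) (coboundary U act k c) = coboundary U act k (T k c))
    (T' : ∀ k, Cochain U' act' k →ₗ[R] Cochain U' act' k)
    (hT' : ∀ k c, T' (k + 1) (coboundary U' act' k c) = coboundary U' act' k (T' k c))
    (k : ℕ) (h : ∀ c, f k (T k c) = T' k (f k c)) (Φ : Hcpt U act k) :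
    Hcpt.map f hf k (Hcpt.map T hT k Φ) = Hcpt.map T' hT' k (Hcpt.map f hf k Φ) := by
  obtain ⟨c, rfl⟩ := Submodule.Quotient.mk_surjective _ Φ
  exact congrArg Submodule.Quotient.mk (Subtype.ext (h c.1))

end Cohomology

/-! ### Behaviour of the kernel polynomial and of `ρ_κ` under `μ ↦ μ * s`. -/

section Specialization

variable {F : Type*} [Field F] [NumberField F] {p : ℕ}

/-- `p` is not a unit of `𝔯_w`, for `w ∣ p`. -/
lemma not_isUnit_natCast (w : PlaceAbove F p) : ¬ IsUnit (p : w.1.adicCompletionIntegers F) := by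
  rw [adicCompletionIntegers.isUnit_iff_valued_eq_one]
  have h := (valuation_lt_one_iff_mem (K := F) w.1 (p : 𝓞 F)).2 w.2
  have e : (((p : w.1.adicCompletionIntegers F)) : w.1.adicCompletion F) =
    algebraMap F (w.1.adicCompletion F) (p : F) := by simp
  rw [e, algebraMap_adicCompletion, Function.comp_apply, Algebra.algebraMap_self, RingHom.id_apply,
    valuedAdicCompletion_eq_valuation']
  simpa using h.ne

variable [Fact p.Prime] {S : TameLevel F p}
variable {K : Type*} [NormedField K] [IsUltrametricDist K] [CharZero K] [NormedAlgebra ℚ_[p] K]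
  [FiniteDimensional ℚ_[p] K]

namespace ArithWeight

variable (κ : ArithWeight S K)

/-- An inverse modulo `p^α` gives `x_w y_w ∈ 1 + p^α 𝔯_w`. Since `α ≥ 1` and `p` lies in the maximal
ideal of `𝔯_w`, the component `x_w` would be a unit. -/
lemma eps_eq_zero {x : Rp F p} {w : PlaceAbove F p} (hx : ¬ IsUnit (x w)) : κ.eps x = 0 := by
  refine κ.ε.map_nonunit fun h => hx ?_
  obtain ⟨y, hy⟩ := h.exists_right_inv
  obtain ⟨y, rfl⟩ := Ideal.Quotient.mk_surjective y
  rw [← map_mul, ← map_one (Ideal.Quotient.mk _), Ideal.Quotient.eq, Ideal.mem_span_singleton] at hy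
  obtain ⟨z, hz⟩ := hy
  have hzw : x w * y w = 1 + (p : w.1.adicCompletionIntegers F) ^ κ.α * z w := by
    have := congrFun hz w
    simp only [Pi.sub_apply, Pi.mul_apply, Pi.one_apply, Pi.pow_apply, Pi.natCast_apply] at this
    rw [← this]; ring
  by_contra hn
  have h1 : x w * y w ∈ IsLocalRing.maximalIdeal (w.1.adicCompletionIntegers F) :=
    Ideal.mul_mem_right _ _ hn
  have hp : (p : w.1.adicCompletionIntegers F) ∈
    IsLocalRing.maximalIdeal (w.1.adicCompletionIntegers F) := not_isUnit_natCast w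
  have h2 : (p : w.1.adicCompletionIntegers F) ^ κ.α * z w ∈
      IsLocalRing.maximalIdeal (w.1.adicCompletionIntegers F) :=
    Ideal.mul_mem_right _ _ (Ideal.pow_mem_of_mem _ hp _ κ.one_le_α)
  rw [hzw] at h1
  have h3 := (Ideal.add_mem_iff_left _ h2).1 h1
  exact h3 isUnit_one

lemma kerPoly_eq_zero {η : Rp F p × Rp F p × Rp F p} {w : PlaceAbove F p}
    (hη : ¬ IsUnit (η.1 w)) : κ.kerPoly η = 0 := by
  rw [kerPoly, κ.eps_eq_zero hη, mul_zero, zero_smul]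

/-- The integrand of the specialization map vanishes outside of `X`. -/
lemma pull_coeffX {s : GLf F} (hs : IsUnit (unitPart p s)) (m : (F →+* K) × Fin 2 →₀ ℕ)
    (η : {η : Rp F p × Rp F p × Rp F p // InX η}) :
    pull S s (κ.coeffX m) (Quotient.mk S.setoidX η) = coeff m (κ.kerPoly (starX p s η.1)) := by
  change extendX S (κ.coeffX m) (starX p s η.1) = _
  by_cases h : InX (starX p s η.1)
  · simp only [extendX, h, dif_pos]
    rfl
  -- The third coordinate stays a unit because `δ(s)` is one, so leaving `X` can only mean that
  -- primitivity fails; in particular the first coordinate is a non-unit somewhere. Extension by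
  -- zero and the factor `ε(x)` thus agree.
  · have h' : ∃ w, ¬ IsUnit ((starX p s η.1).1 w) := by
      by_contra! hw
      exact h ⟨fun w => Or.inl (hw w), η.2.2.mul hs⟩
    obtain ⟨w, hw⟩ := h'
    rw [κ.kerPoly_eq_zero hw, coeff_zero]
    simp only [extendX, h, dif_neg, not_false_eq_true]

/-- The substitution sends `xY - yX` to `(xa + yc)Y - (xb + yd)X`, which is the same form at `(x, y)
s`, without a determinant factor. The scalar `t` accounts for the use of `δ(s)` in place of the
determinant. -/
lemma kerPoly_starX {s : GLf F} (hs : s ∈ Delta0 (Ideal.span {(p : 𝓞 F) ^ κ.α})) {t : K}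
    (hu : IsUnit (unitPart p s)) (ht : κ.powV (unitPart p s) = t * κ.powV (pMat p s).det)
    (η : Rp F p × Rp F p × Rp F p) :
    κ.kerPoly (starX p s η) = (κ.eps (pMat p s 0 0) * toO (t * κ.powV (pMat p s).det)) •
      subst K (pMat p s) (κ.kerPoly η) := by
  rw [kerPoly, kerPoly, map_smul, smul_smul, map_prod]
  congr 1
  · simp only [starX, powV_mul]
    -- Here `z` is arbitrary, so `z^v` need not be integral. The factor `δ(s)^v` has norm `1` and
    -- can be split off even where `toO` takes its default value.
    rw [toO_mul_of_norm_eq_one _ _ (κ.norm_powV hu),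
      κ.eps_add (Ideal.mul_mem_left _ _ (pMat_mem_span hs)), eps_mul, ht]
    ring
  · refine Finset.prod_congr rfl fun σ _ => ?_
    rw [map_pow]
    congr 1
    simp [starX, subst]
    ring

/-- The specialization map is equivariant for the elements of `Δ₀(p^α)`, up to the
normalization of the determinant. -/
lemma rho_measAct {s : GLf F} (hs : s ∈ Delta0 (Ideal.span {(p : 𝓞 F) ^ κ.α})) {t : K}
    (hu : IsUnit (unitPart p s)) (ht : κ.powV (unitPart p s) = t * κ.powV (pMat p s).det)
    (μ : Meas S K) : κ.rho (measAct S s μ) = κ.slash t s (κ.rho μ) := by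
  apply Subtype.ext
  refine MvPolynomial.ext _ _ fun m => ?_
  rw [coeff_rho, slash_apply, coeff_smul, rho_coe, measAct_apply, map_sum, coeff_sum]
  -- A measure takes only scalar functions, so the polynomial identity is read off in the monomial
  -- basis: the pulled-back coefficient function is a combination, with coefficients independent of
  -- `η`, of the functions `κ.coeffX m'`. Linearity of `μ` then finishes.
  have key : pull S s (κ.coeffX m) = ∑ m' ∈ κ.monos,
      ((κ.eps (pMat p s 0 0) * toO (t * κ.powV (pMat p s).det)) *
        coeff m (subst K (pMat p s) (monomial m' 1))) • κ.coeffX m' := by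
    apply ContinuousMap.ext
    rintro ⟨η⟩
    have h2 : ∀ m', κ.coeffX m' (Quot.mk _ η) = coeff m' (κ.kerPoly η.1) := fun m' => rfl
    refine (κ.pull_coeffX hu m η).trans ?_
    rw [κ.kerPoly_starX hs hu ht η.1, coeff_smul, κ.kerPoly_sum η.1, map_sum, coeff_sum,
      Finset.smul_sum]
    refine Eq.trans ?_ (sum_smul_apply _ _ _ _).symm
    refine Finset.sum_congr rfl fun m' _ => ?_
    rw [h2, ← mul_one (coeff m' (κ.kerPoly η.1)),
      ← smul_eq_mul (coeff m' (κ.kerPoly η.1)), ← smul_monomial, map_smul, coeff_smul]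
    simp only [smul_eq_mul]
    ring
  rw [key, map_sum, Finset.smul_sum]
  refine Finset.sum_congr rfl fun m' _ => ?_
  rw [map_smul, ← mul_one (μ (κ.coeffX m')), ← smul_eq_mul (μ (κ.coeffX m')), ← smul_monomial,
    map_smul, coeff_smul]
  simp only [smul_eq_mul]
  ring

/-- The specialization of `μ * s` vanishes if the first column of `s` is not primitive at some
`w ∣ p`. -/
lemma rho_measAct_eq_zero {s : GLf F} (hu : IsUnit (unitPart p s)) {w : PlaceAbove F p}
    (h0 : ¬ IsUnit (pMat p s 0 0 w)) (h1 : ¬ IsUnit (pMat p s 1 0 w)) (μ : Meas S K) :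
    κ.rho (measAct S s μ) = 0 := by
  apply Subtype.ext
  refine MvPolynomial.ext _ _ fun m => ?_
  rw [coeff_rho, measAct_apply]
  have key : pull S s (κ.coeffX m) = 0 := by
    apply ContinuousMap.ext
    rintro ⟨η⟩
    refine (κ.pull_coeffX hu m η).trans ?_
    rw [κ.kerPoly_eq_zero (w := w), coeff_zero]
    · rfl
    -- The first coordinate of `η * s` is `x a + y c`, with `a` and `c` in the maximal ideal at `w`.
    · exact Ideal.add_mem (IsLocalRing.maximalIdeal (w.1.adicCompletionIntegers F))
        (Ideal.mul_mem_left _ _ h0) (Ideal.mul_mem_left _ _ h1)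
  rw [key, map_zero]
  rfl

end ArithWeight

end Specialization

/-! ### Matrix computations at one prime above `p`. -/

section LocalMatrices

/-- The unipotent matrix `(1, b; 0, 1)`. -/
def unipotent {R : Type*} [CommRing R] (b : R) : GL (Fin 2) R where
  val := !![1, b; 0, 1]
  inv := !![1, -b; 0, 1]
  val_inv := by simp [Matrix.one_fin_two]
  inv_val := by simp [Matrix.one_fin_two]

lemma unipotent_mem_localGamma {R : Type*} [CommRing R] (J : Ideal R) (b : R) :
    unipotent b ∈ localGamma J := by
  refine ⟨⟨?_, ?_⟩, ?_⟩ <;> simp [unipotent]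

/-- If `k = (a, b; c, d)` with `c ∈ J` and `l = (a, b'; π c, d)` with `b' π = b`, then `l k⁻¹` is
congruent to a unipotent matrix modulo `J`. -/
lemma mul_inv_mem_localGamma {R : Type*} [CommRing R] {J : Ideal R} {k l : GL (Fin 2) R}
    (hk : k ∈ localGamma0 J) {π : R} (h00 : l 0 0 = k 0 0) (h10 : l 1 0 = π * k 1 0)
    (h11 : l 1 1 = k 1 1) : l * k⁻¹ ∈ localGamma J := by
  have hk' : k 1 0 ∈ J := hk
  have h1 := GL_det_inv_mul k
  set D : R := ((k.det⁻¹ : Rˣ) : R)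
  have e : ((l * k⁻¹ : GL (Fin 2) R) : Matrix (Fin 2) (Fin 2) R) =
      (l : Matrix (Fin 2) (Fin 2) R) * (D • !![k 1 1, -k 0 1; -k 1 0, k 0 0]) := by
    rw [Units.val_mul, GL_inv_apply, Matrix.adjugate_fin_two]
  refine ⟨⟨?_, ?_⟩, ?_⟩ <;> rw [e] <;>
    simp only [Matrix.mul_apply, Fin.sum_univ_two, Matrix.smul_apply, Matrix.of_apply,
      Matrix.cons_val', Matrix.cons_val_zero, Matrix.cons_val_one, smul_eq_mul,
      Matrix.cons_val_fin_one, h00, h10, h11]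
  -- In all three cases the entry, diminished on the diagonal by `1 = D * det k`, is an explicit
  -- multiple of `k 1 0`, which lies in `J`.
  · rw [show π * k 1 0 * (D * k 1 1) + k 1 1 * (D * -k 1 0) =
      (π * D * k 1 1 - k 1 1 * D) * k 1 0 by ring]
    exact J.mul_mem_left _ hk'
  · rw [show k 0 0 * (D * k 1 1) + l 0 1 * (D * -k 1 0) - 1 =
      (D * k 0 1 - l 0 1 * D) * k 1 0 by linear_combination h1]
    exact J.mul_mem_left _ hk'
  · rw [show π * k 1 0 * (D * -k 0 1) + k 1 1 * (D * k 0 0) - 1 =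
      (D * k 0 1 - π * D * k 0 1) * k 1 0 by linear_combination h1]
    exact J.mul_mem_left _ hk'

/-- If the upper left entry of `k` is a unit, then `(1, 0; 0, π) k` is equivalent to
`(1, 0; 0, π) u` with a unipotent matrix `u`. -/
lemma exists_mul_diag_unipotent {R : Type*} [CommRing R] (k : GL (Fin 2) R) (hk : IsUnit (k 0 0))
    (π : R) : ∃ (l : GL (Fin 2) R) (b : R),
      (l : Matrix (Fin 2) (Fin 2) R) * (!![1, 0; 0, π] * (unipotent b : GL (Fin 2) R)) =
        !![1, 0; 0, π] * (k : Matrix (Fin 2) (Fin 2) R) := by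
  obtain ⟨a, ha⟩ := hk
  have ha' : k 0 0 * ((a⁻¹ : Rˣ) : R) = 1 := by rw [← ha, Units.mul_inv]
  set i : R := ((a⁻¹ : Rˣ) : R)
  -- Formally `l` is the conjugate of `k * (unipotent b)⁻¹` by `(1, 0; 0, π)`, whose upper right
  -- entry is `(k 0 1 - k 0 0 * b) / π`. The choice `b = k 0 1 / k 0 0` makes it zero, so no
  -- division by `π` is needed, and `det l = det k` is a unit.
  have hdet : IsUnit (!![k 0 0, 0; π * k 1 0, k 1 1 - k 1 0 * (k 0 1 * i)] :
      Matrix (Fin 2) (Fin 2) R).det := by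
    rw [Matrix.det_fin_two_of]
    convert k.det.isUnit using 1
    rw [Matrix.GeneralLinearGroup.val_det_apply, Matrix.det_fin_two]
    linear_combination (-k 1 0 * k 0 1) * ha'
  refine ⟨Matrix.GeneralLinearGroup.mk'' _ hdet, k 0 1 * i, ?_⟩
  change !![k 0 0, 0; π * k 1 0, k 1 1 - k 1 0 * (k 0 1 * i)] *
    (!![1, 0; 0, π] * !![1, k 0 1 * i; 0, 1]) = _
  rw [Matrix.eta_fin_two (k : Matrix (Fin 2) (Fin 2) R)]
  ext r s
  fin_cases r <;> fin_cases s <;> simp [Matrix.mul_apply, Fin.sum_univ_two]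
  · linear_combination (k 0 1) * ha'
  · ring

end LocalMatrices

/-! ### Local descriptions of the level groups, and modification of adelic matrices at `p`. -/

section Places

variable {F : Type*} [Field F] [NumberField F] {p : ℕ}

lemma compAt_apply (w : HeightOneSpectrum (𝓞 F)) (g : GLf F) (i j : Fin 2) :
    compAt w g i j = g i j w := rfl

lemma exists_comp_of_mem_globalize
    {H : ∀ w : HeightOneSpectrum (𝓞 F), Subgroup (GL (Fin 2) (w.adicCompletionIntegers F))}
    {g : GLf F} (hg : g ∈ globalize H) (w : HeightOneSpectrum (𝓞 F)) :
    ∃ l ∈ H w, Matrix.GeneralLinearGroup.map (inclAt w) l = compAt w g := by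
  simp only [globalize, Subgroup.mem_iInf, Subgroup.mem_comap, Subgroup.mem_map] at hg
  exact hg w

lemma mem_globalize
    {H : ∀ w : HeightOneSpectrum (𝓞 F), Subgroup (GL (Fin 2) (w.adicCompletionIntegers F))}
    {g : GLf F}
    (hg : ∀ w, ∃ l ∈ H w, Matrix.GeneralLinearGroup.map (inclAt w) l = compAt w g) :
    g ∈ globalize H := by
  simpa only [globalize, Subgroup.mem_iInf, Subgroup.mem_comap, Subgroup.mem_map] using hg

lemma pMat_eq_of_comp {g : GLf F} {w : PlaceAbove F p} {l : GL (Fin 2) (w.1.adicCompletionIntegers F)}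
    (hl : Matrix.GeneralLinearGroup.map (inclAt w.1) l = compAt w.1 g) (i j : Fin 2) :
    pMat p g i j w = l i j := by
  have h : g i j w.1 = ((l i j : w.1.adicCompletionIntegers F) : w.1.adicCompletion F) := by
    rw [← compAt_apply, ← hl]; rfl
  simp only [pMat, Matrix.of_apply, h, toInt_coe]

lemma isUnit_natCast {w : HeightOneSpectrum (𝓞 F)} (hw : (p : 𝓞 F) ∉ w.asIdeal) :
    IsUnit (p : w.adicCompletionIntegers F) := by
  rw [adicCompletionIntegers.isUnit_iff_valued_eq_one]
  have h := mt (valuation_lt_one_iff_mem (K := F) w (p : 𝓞 F)).1 hw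
  have e : (((p : w.adicCompletionIntegers F)) : w.adicCompletion F) =
    algebraMap F (w.adicCompletion F) (p : F) := by simp
  rw [e, algebraMap_adicCompletion, Function.comp_apply, Algebra.algebraMap_self, RingHom.id_apply,
    valuedAdicCompletion_eq_valuation']
  have h2 := valuation_le_one (K := F) w (p : 𝓞 F)
  simpa using le_antisymm h2 (not_lt.1 h)

/-- Away from `p` the number `p` is a unit, so congruences modulo `p^α` impose nothing there. -/
lemma idealAt_span_eq_top {w : HeightOneSpectrum (𝓞 F)} (hw : (p : 𝓞 F) ∉ w.asIdeal) (α : ℕ) :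
    idealAt (Ideal.span {(p : 𝓞 F) ^ α}) w = ⊤ := by
  rw [idealAt, Ideal.map_span, Set.image_singleton, Ideal.span_singleton_eq_top, map_pow,
    map_natCast]
  exact (isUnit_natCast hw).pow α

/-- By coprimality `1 = p c + b` with `b` in the tame conductor. Since `p` is in the maximal ideal
at `w`, the element `b` must be a unit there; the tame level imposes no condition at `p`. -/
lemma TameLevel.idealAt_cond (S : TameLevel F p) (w : PlaceAbove F p) :
    idealAt S.cond w.1 = ⊤ := by
  obtain ⟨a, ha, b, hb, hab⟩ := Ideal.isCoprime_iff_exists.1 S.cond_coprime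
  obtain ⟨c, rfl⟩ := Ideal.mem_span_singleton.1 ha
  refine Ideal.eq_top_of_isUnit_mem _ (Ideal.mem_map_of_mem _ hb) ?_
  by_contra hn
  have hp : (p : w.1.adicCompletionIntegers F) ∈
    IsLocalRing.maximalIdeal (w.1.adicCompletionIntegers F) := not_isUnit_natCast w
  have h := congrArg (algebraMap (𝓞 F) (w.1.adicCompletionIntegers F)) hab
  rw [map_add, map_mul, map_natCast, map_one] at h
  have h2 : (1 : w.1.adicCompletionIntegers F) ∈
      IsLocalRing.maximalIdeal (w.1.adicCompletionIntegers F) := by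
    rw [← h]
    exact Ideal.add_mem _ (Ideal.mul_mem_right _ _ hp) hn
  exact h2 isUnit_one

/-- The `p`-component of `S` is `GL₂(𝔯_p)`. -/
lemma TameLevel.mem_of_comp (S : TameLevel F p) {g : GLf F}
    (haway : ∀ w : HeightOneSpectrum (𝓞 F), (p : 𝓞 F) ∉ w.asIdeal → compAt w g = 1)
    (hp : ∀ w : PlaceAbove F p, ∃ l, Matrix.GeneralLinearGroup.map (inclAt w.1) l = compAt w.1 g) :
    g ∈ S.S := by
  refine S.U1_le (mem_globalize fun w => ?_)
  by_cases hw : (p : 𝓞 F) ∈ w.asIdeal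
  · obtain ⟨l, hl⟩ := hp ⟨w, hw⟩
    have ht : idealAt S.cond w = ⊤ := S.idealAt_cond ⟨w, hw⟩
    refine ⟨l, ?_, hl⟩
    rw [ht]
    exact ⟨trivial, trivial⟩
  · exact ⟨1, one_mem _, by rw [haway w hw, map_one]⟩

/-- For a matrix in `GL₂` of the integral adeles, membership in `U(p^α)` need only be tested above
`p`. -/
lemma mem_Ufull_of_comp {g : GLf F} (hg : g ∈ U0 (⊤ : Ideal (𝓞 F))) {α : ℕ}
    (hp : ∀ w : PlaceAbove F p, ∃ l ∈ localGamma (idealAt (Ideal.span {(p : 𝓞 F) ^ α}) w.1),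
      Matrix.GeneralLinearGroup.map (inclAt w.1) l = compAt w.1 g) :
    g ∈ Ufull (Ideal.span {(p : 𝓞 F) ^ α}) := by
  refine mem_globalize fun w => ?_
  by_cases hw : (p : 𝓞 F) ∈ w.asIdeal
  · exact hp ⟨w, hw⟩
  · obtain ⟨l, -, hl⟩ := exists_comp_of_mem_globalize hg w
    refine ⟨l, ?_, hl⟩
    rw [idealAt_span_eq_top hw]
    exact ⟨⟨trivial, trivial⟩, trivial⟩

/-- The adelic matrix with the components `M w` at the primes `w ∣ p` and the components of `A` at
the other primes. -/
noncomputable def glueMat (M : ∀ w : PlaceAbove F p, Matrix (Fin 2) (Fin 2) (w.1.adicCompletionIntegers F))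
    (A : Matrix (Fin 2) (Fin 2) (FiniteAdeleRing (𝓞 F) F)) :
    Matrix (Fin 2) (Fin 2) (FiniteAdeleRing (𝓞 F) F) :=
  Matrix.of fun i j => ⟨fun w => open Classical in
    if h : (p : 𝓞 F) ∈ w.asIdeal then (M ⟨w, h⟩ i j : w.adicCompletion F) else A i j w, by
      -- The new components are integral at every place where they are used, so the restricted
      -- product condition is inherited from `A`.
      filter_upwards [(A i j).2] with w hw
      split_ifs with h
      · exact (M ⟨w, h⟩ i j).2
      · exact hw⟩

lemma glueMat_above (M : ∀ w : PlaceAbove F p, Matrix (Fin 2) (Fin 2) (w.1.adicCompletionIntegers F))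
    (A : Matrix (Fin 2) (Fin 2) (FiniteAdeleRing (𝓞 F) F)) (w : PlaceAbove F p) :
    (evalAt w.1).mapMatrix (glueMat M A) = (inclAt w.1).mapMatrix (M w) := by
  refine Matrix.ext fun i j => ?_
  exact dif_pos w.2

lemma glueMat_away (M : ∀ w : PlaceAbove F p, Matrix (Fin 2) (Fin 2) (w.1.adicCompletionIntegers F))
    (A : Matrix (Fin 2) (Fin 2) (FiniteAdeleRing (𝓞 F) F)) {w : HeightOneSpectrum (𝓞 F)}
    (hw : (p : 𝓞 F) ∉ w.asIdeal) :
    (evalAt w).mapMatrix (glueMat M A) = (evalAt w).mapMatrix A := by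
  refine Matrix.ext fun i j => ?_
  exact dif_neg hw

lemma adelicMatrix_ext {A B : Matrix (Fin 2) (Fin 2) (FiniteAdeleRing (𝓞 F) F)}
    (h : ∀ w, (evalAt w).mapMatrix A = (evalAt w).mapMatrix B) : A = B := by
  refine Matrix.ext fun i j => DFunLike.ext _ _ fun w => ?_
  exact congrFun (congrFun (h w) i) j

/-- The identity is checked place by place; with the roles exchanged it gives both inverse laws for
`glue`. -/
lemma glueMat_mul_eq_one
    {M N : ∀ w : PlaceAbove F p, Matrix (Fin 2) (Fin 2) (w.1.adicCompletionIntegers F)}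
    {A B : Matrix (Fin 2) (Fin 2) (FiniteAdeleRing (𝓞 F) F)} (hM : ∀ w, M w * N w = 1)
    (hA : A * B = 1) : glueMat M A * glueMat N B = 1 := by
  refine adelicMatrix_ext fun w => ?_
  rw [map_mul, map_one]
  by_cases hw : (p : 𝓞 F) ∈ w.asIdeal
  · rw [glueMat_above M A ⟨w, hw⟩, glueMat_above N B ⟨w, hw⟩, ← map_mul, hM, map_one]
  · rw [glueMat_away M A hw, glueMat_away N B hw, ← map_mul, hA, map_one]

/-- The element of `GL₂(F̂)` with the components `M w` at the primes `w ∣ p` and the components of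
`k` at the other primes. -/
noncomputable def glue (M : ∀ w : PlaceAbove F p, GL (Fin 2) (w.1.adicCompletionIntegers F)) (k : GLf F) :
    GLf F where
  val := glueMat (fun w => (M w).1) k.1
  inv := glueMat (fun w => (M w).2) k.2
  val_inv := glueMat_mul_eq_one (fun w => (M w).3) k.3
  inv_val := glueMat_mul_eq_one (fun w => (M w).4) k.4

lemma compAt_glue_above (M : ∀ w : PlaceAbove F p, GL (Fin 2) (w.1.adicCompletionIntegers F))
    (k : GLf F) (w : PlaceAbove F p) :
    compAt w.1 (glue M k) = Matrix.GeneralLinearGroup.map (inclAt w.1) (M w) :=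
  Units.ext (glueMat_above (fun w => (M w).1) k.1 w)

lemma compAt_glue_away (M : ∀ w : PlaceAbove F p, GL (Fin 2) (w.1.adicCompletionIntegers F))
    (k : GLf F) {w : HeightOneSpectrum (𝓞 F)} (hw : (p : 𝓞 F) ∉ w.asIdeal) :
    compAt w (glue M k) = compAt w k :=
  Units.ext (glueMat_away (fun w => (M w).1) k.1 hw)

/-- `v_w(p) = 1` if `p` is unramified and `w ∣ p`. -/
lemma valued_natCast_of_squarefree (hunr : Squarefree (Ideal.span {(p : 𝓞 F)}))
    (w : PlaceAbove F p) : Valued.v (p : w.1.adicCompletion F) = WithZero.exp (-1 : ℤ) := by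
  have e : (p : w.1.adicCompletion F) = algebraMap F (w.1.adicCompletion F) (p : F) := by simp
  rw [e, algebraMap_adicCompletion, Function.comp_apply, Algebra.algebraMap_self, RingHom.id_apply,
    valuedAdicCompletion_eq_valuation', ← map_natCast (algebraMap (𝓞 F) F) p,
    valuation_of_algebraMap]
  -- The additive valuation of `p` is at least `1` because `w ∣ p`. It is less than `2`, as
  -- otherwise the square of the prime ideal would divide the squarefree ideal `(p)`.
  have h1 : w.1.intValuation (p : 𝓞 F) ≤ WithZero.exp (-((1 : ℕ) : ℤ)) := by
    rw [intValuation_le_pow_iff_mem, pow_one]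
    exact w.2
  have h2 : ¬ w.1.intValuation (p : 𝓞 F) ≤ WithZero.exp (-((2 : ℕ) : ℤ)) := by
    rw [intValuation_le_pow_iff_dvd, pow_two]
    exact fun h => w.1.isPrime.ne_top (Ideal.isUnit_iff.1 (hunr _ h))
  have h0 : w.1.intValuation (p : 𝓞 F) ≠ 0 := fun h => h2 (by rw [h]; exact zero_le)
  -- Passing to exponents leaves an integer that is at most `-1` and greater than `-2`.
  rw [← WithZero.exp_log h0] at h1 h2 ⊢
  rw [WithZero.exp_le_exp] at h1 h2
  congr 1
  push_cast at h1 h2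
  omega

lemma compAt_diagOne (q : (FiniteAdeleRing (𝓞 F) F)ˣ) (w : HeightOneSpectrum (𝓞 F)) :
    (compAt w (diagOne q) : Matrix (Fin 2) (Fin 2) (w.adicCompletion F)) =
      !![1, 0; 0, (q : FiniteAdeleRing (𝓞 F) F) w] := by
  ext i j
  fin_cases i <;> fin_cases j <;> rfl

lemma compAt_diagOne_of_eq_one {q : (FiniteAdeleRing (𝓞 F) F)ˣ} {w : HeightOneSpectrum (𝓞 F)}
    (hq : (q : FiniteAdeleRing (𝓞 F) F) w = 1) : compAt w (diagOne q) = 1 := by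
  apply Units.ext
  rw [compAt_diagOne, hq, Units.val_one, Matrix.one_fin_two]

lemma evalAt_det_diagOne (q : (FiniteAdeleRing (𝓞 F) F)ˣ) (w : HeightOneSpectrum (𝓞 F)) :
    evalAt w ((diagOne q).det : (FiniteAdeleRing (𝓞 F) F)ˣ) =
      (q : FiniteAdeleRing (𝓞 F) F) w := by
  have : (((diagOne q).det : (FiniteAdeleRing (𝓞 F) F)ˣ) : FiniteAdeleRing (𝓞 F) F) = q := by
    rw [Matrix.GeneralLinearGroup.val_det_apply]
    simp [diagOne]
  rw [this]; rfl

end Places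

/-! ### Cosets at the levels `U` and `S`, and the two commutation relations. -/

section ModularSymbols

variable {F : Type*} [Field F] [NumberField F] {p : ℕ} [Fact p.Prime]
variable {S : TameLevel F p}
variable {K : Type*} [NormedField K] [IsUltrametricDist K] [CharZero K] [NormedAlgebra ℚ_[p] K]
  [FiniteDimensional ℚ_[p] K]

namespace ArithWeight.Level

variable {κ : ArithWeight S K} (V : κ.Level)

/-- The group `V.U` is only known to lie between `S ∩ U(p^α)` and `S ∩ U₀(p^α)`. The condition is
therefore put on the commutator, which can be tested in `U(p^α)` at `p`; multiplying it by `u`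
returns to `V.U`. -/
lemma mul_mul_inv_mem {x u : GLf F} (hu : u ∈ V.U) (hx : x * u * x⁻¹ ∈ S.S)
    (hp : ∀ w : PlaceAbove F p, ∃ l ∈ localGamma (idealAt (Ideal.span {(p : 𝓞 F) ^ κ.α}) w.1),
      Matrix.GeneralLinearGroup.map (inclAt w.1) l = compAt w.1 (x * u * x⁻¹ * u⁻¹)) :
    x * u * x⁻¹ ∈ V.U := by
  have hS : x * u * x⁻¹ * u⁻¹ ∈ S.S := S.S.mul_mem hx (S.S.inv_mem (V.le_S hu))
  have h := V.U.mul_mem (V.ge ⟨hS, mem_Ufull_of_comp (S.le_U0_top hS) hp⟩) hu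
  rwa [inv_mul_cancel_right] at h

/-- This makes it a question at `p` alone whether the coset of `x k` comes from `U`. The witness `u`
is `k` with its components at `p` replaced by `M`. Away from `p` the element `x k (x u)⁻¹` is then
`1`, and at `p` it is the integral matrix `l` of `hp`. -/
lemma exists_mem_of_comp {x k : GLf F} (hk : k ∈ S.S)
    (M : ∀ w : PlaceAbove F p, GL (Fin 2) (w.1.adicCompletionIntegers F))
    (hM : ∀ w, M w ∈ localGamma (idealAt (Ideal.span {(p : 𝓞 F) ^ κ.α}) w.1))
    (hp : ∀ w : PlaceAbove F p, ∃ l, Matrix.GeneralLinearGroup.map (inclAt w.1) l *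
      (compAt w.1 x * Matrix.GeneralLinearGroup.map (inclAt w.1) (M w)) =
        compAt w.1 x * compAt w.1 k) :
    ∃ u ∈ V.U, x * k * (x * u)⁻¹ ∈ S.S := by
  -- The quotient by `k` is trivial away from `p` and integral invertible at `p`, hence lies in `S`;
  -- so does the glued element.
  have hS : glue M k * k⁻¹ ∈ S.S := by
    refine S.mem_of_comp (fun w hw => ?_) fun w => ?_
    · rw [map_mul, map_inv, compAt_glue_away M k hw, mul_inv_cancel]
    · obtain ⟨l, -, hl⟩ := exists_comp_of_mem_globalize (S.le_U0_top hk) w.1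
      exact ⟨M w * l⁻¹, by rw [map_mul, map_mul, map_inv, map_inv, hl, compAt_glue_above]⟩
  have hS' : glue M k ∈ S.S := by simpa using S.S.mul_mem hS hk
  refine ⟨glue M k, V.ge ⟨hS', mem_Ufull_of_comp (S.le_U0_top hS') fun w =>
    ⟨M w, hM w, (compAt_glue_above M k w).symm⟩⟩, S.mem_of_comp (fun w hw => ?_) fun w => ?_⟩
  · rw [map_mul, map_inv, map_mul, map_mul, compAt_glue_away M k hw, mul_inv_cancel]
  · obtain ⟨l, hl⟩ := hp w
    refine ⟨l, ?_⟩
    rw [map_mul, map_inv, map_mul, map_mul, compAt_glue_above, ← hl, mul_inv_cancel_right]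

/-- The specialization map commutes with the Hecke operator of `x`, if the cosets in `U \ U x U`
stay distinct in `S \ S x S` and the terms of the remaining cosets are killed. -/
lemma rho_T_eq_scaledT {x : GLf F} (hx : x ∈ Delta0 (Ideal.span {(p : 𝓞 F) ^ κ.α}))
    (hx' : x ∈ Delta0 (⊤ : Ideal (𝓞 F))) {t : K} (hux : unitPart p x = 1)
    (htx : t * κ.powV (pMat p x).det = 1)
    (hinj : ∀ u ∈ V.U, x * u * x⁻¹ ∈ S.S → x * u * x⁻¹ ∈ V.U)
    (hzero : ∀ k ∈ S.S, (∃ u ∈ V.U, x * k * (x * u)⁻¹ ∈ S.S) ∨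
      ∀ a ∈ S.S, ∀ μ : Meas S K, κ.rho (measAct S (a * x * k) μ) = 0)
    (Φ : LambdaSymbols S K) :
    V.rho (LambdaSymbols.T S K x hx' Φ) = V.scaledT t x hx (V.rho Φ) := by
  have hcomm : ∀ a ∈ V.U, ∀ b ∈ V.U, ∀ μ : Meas S K,
      κ.rho (measAct S (a * x * b) μ) = κ.slash t (a * x * b) (κ.rho μ) := by
    intro a ha b hb μ
    have ha' := S.le_U0_top (V.le_S ha)
    have hb' := S.le_U0_top (V.le_S hb)
    -- For `a` and `b` the unit part is the determinant itself, while `x` contributes `1`. So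
    -- `det(s)^v` differs from `δ(s)^v` only by the factor of `x`, which `t` cancels by `htx`.
    have hu : unitPart p (a * x * b) = (pMat p a).det * (pMat p b).det := by
      rw [unitPart_mul_unit _ hb', unitPart_unit_mul _ ha', hux, mul_one]
    refine κ.rho_measAct (mul_mem (mul_mem (U0_le_Delta0 _ _ (V.le_U0 ha)) hx)
      (U0_le_Delta0 _ _ (V.le_U0 hb))) ?_ ?_ μ
    · rw [hu]
      exact (isUnit_det_pMat p ha').mul (isUnit_det_pMat p hb')
    · rw [hu, pMat_mul p (mul_mem (U0_le_Delta0 _ _ ha') hx') (U0_le_Delta0 _ _ hb'),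
        pMat_mul p (U0_le_Delta0 _ _ ha') hx', Matrix.det_mul, Matrix.det_mul, powV_mul, powV_mul,
        powV_mul]
      linear_combination (-κ.powV (pMat p a).det * κ.powV (pMat p b).det) * htx
  refine Hcpt.map_comm V.rhoCochain V.rhoCochain_coboundary
    _ (heckeCochain_coboundary _ _ _ _ _) _ (heckeCochain_coboundary _ _ _ _ _) _
    (fun c => Subtype.ext ?_) Φ
  funext g τ
  exact heckeFun_comp (R := OK K) (E := Meas S K) (E' := κ.L) (op' := κ.slash t) V.le_S S.isOpen
    S.isCompact (measAct_compat S hx') κ.rho hinj hcomm hzero c g τ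

end ArithWeight.Level

/-- The specialization map commutes with `T(x)` if the component of `x` at `p` is trivial. -/
lemma rho_T_of_eq_one_above {κ : ArithWeight S K} (V : κ.Level)
    {q : (FiniteAdeleRing (𝓞 F) F)ˣ} (hq : IsIntegralIdele q)
    (hq1 : ∀ w : PlaceAbove F p, (q : FiniteAdeleRing (𝓞 F) F) w.1 = 1) (Φ : LambdaSymbols S K) :
    V.rho (LambdaSymbols.T S K (diagOne q) (diagOne_mem hq _) Φ) =
      V.T (diagOne q) (diagOne_mem hq _) (V.rho Φ) := by
  have hc : ∀ w : PlaceAbove F p, compAt w.1 (diagOne q) = 1 := fun w =>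
    compAt_diagOne_of_eq_one (hq1 w)
  have hpm : pMat p (diagOne q) = 1 := by
    refine Matrix.ext fun i j => funext fun w => ?_
    rw [pMat_eq_of_comp (l := 1) (by rw [map_one, hc w])]
    fin_cases i <;> fin_cases j <;> rfl
  refine V.rho_T_eq_scaledT _ _ ?_ ?_ ?_ ?_ Φ
  · funext w
    rw [unitPart, evalAt_det_diagOne, hq1 w, map_one, WithZero.log_one, zpow_zero, mul_one]
    exact toInt_coe w.1 1
  · rw [hpm, Matrix.det_one, ArithWeight.powV]
    simp
  · intro u hu hS
    -- Above `p` the commutator reduces to `u u⁻¹ = 1`.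
    refine V.mul_mul_inv_mem hu hS fun w => ⟨1, one_mem _, ?_⟩
    simp [hc w]
  · intro k hk
    -- No coset is left over: `k` may be replaced by `1` above `p`, at the cost of the left factor
    -- `l = k_w`, because `x` is trivial there.
    refine Or.inl (V.exists_mem_of_comp hk (fun _ => 1) (fun _ => one_mem _) fun w => ?_)
    obtain ⟨l, -, hl⟩ := exists_comp_of_mem_globalize (S.le_U0_top hk) w.1
    exact ⟨l, by simp [hc w, hl]⟩

/-- The specialization map commutes with the normalized operator at `p`. -/
lemma rho_T_eq_T0 (hunr : Squarefree (Ideal.span {(p : 𝓞 F)})) {κ : ArithWeight S K} (V : κ.Level)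
    {ϖ : (FiniteAdeleRing (𝓞 F) F)ˣ} (hϖ : IsPIdele p ϖ) (Φ : LambdaSymbols S K) :
    V.rho (LambdaSymbols.T S K (diagOne ϖ) (diagOne_mem hϖ.isIntegral _) Φ) =
      V.T0 ϖ hϖ (V.rho Φ) := by
  have hp0 : ∀ w : PlaceAbove F p, (p : w.1.adicCompletion F) ≠ 0 := fun w => by
    rw [← map_natCast (algebraMap F (w.1.adicCompletion F)), Ne, map_eq_zero]
    exact_mod_cast (Fact.out : p.Prime).ne_zero
  have hc : ∀ w : PlaceAbove F p,
      (compAt w.1 (diagOne ϖ) : Matrix (Fin 2) (Fin 2) (w.1.adicCompletion F)) =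
        (inclAt w.1).mapMatrix !![1, 0; 0, (p : w.1.adicCompletionIntegers F)] := fun w => by
    rw [compAt_diagOne, hϖ.1 w.1 w.2]
    refine Matrix.ext fun i j => ?_
    fin_cases i <;> fin_cases j <;> simp
  have hxΔ : diagOne ϖ ∈ Delta0 (⊤ : Ideal (𝓞 F)) := diagOne_mem hϖ.isIntegral _
  have hpm : pMat p (diagOne ϖ) = !![1, 0; 0, (p : Rp F p)] := by
    refine Matrix.ext fun i j => funext fun w => Subtype.ext ?_
    rw [pMat_coe p hxΔ, ← compAt_apply, hc w]
    fin_cases i <;> fin_cases j <;> rfl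
  -- This is where unramifiedness enters: the determinant is `p`, of valuation exactly `1` at each
  -- `w ∣ p`, so the normalization divides by `p` once.
  have hux : unitPart p (diagOne ϖ) = 1 := by
    funext w
    rw [unitPart, evalAt_det_diagOne, hϖ.1 w.1 w.2, valued_natCast_of_squarefree hunr,
      WithZero.log_exp, zpow_neg_one, mul_inv_cancel₀ (hp0 w)]
    exact toInt_coe w.1 1
  refine V.rho_T_eq_scaledT _ _ hux ?_ ?_ ?_ Φ
  -- Every embedding fixes the rational number `p`, so `det(x_p)^v` is `{p}^v`, the inverse of the
  -- scalar in `T₀(p)`.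
  · rw [hpm, Matrix.det_fin_two_of, ArithWeight.powV]
    simp only [one_mul, mul_zero, sub_zero, map_natCast]
    push_cast
    exact inv_mul_cancel₀ (Finset.prod_ne_zero_iff.2 fun σ _ =>
      zpow_ne_zero _ (natCast_prime_ne_zero p))
  · intro u hu hS
    refine V.mul_mul_inv_mem hu hS fun w => ?_
    obtain ⟨k, hk, hku⟩ := exists_comp_of_mem_globalize (V.le_U0 hu) w.1
    obtain ⟨l, -, hly⟩ := exists_comp_of_mem_globalize (S.le_U0_top hS) w.1
    refine ⟨l * k⁻¹, ?_, by rw [map_mul, map_inv, hly, hku, map_mul _ _ u⁻¹, map_inv]⟩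
    -- Conjugation is written without inverses, so that it descends from `F_w` to `𝔯_w`. Comparing
    -- entries gives the diagonal of `k` and `p c` in the lower left corner, which is the input of
    -- `mul_inv_mem_localGamma` with `π = p`.
    have hmat : (l : Matrix (Fin 2) (Fin 2) (w.1.adicCompletionIntegers F)) *
        !![1, 0; 0, (p : w.1.adicCompletionIntegers F)] =
        !![1, 0; 0, (p : w.1.adicCompletionIntegers F)] * k := by
      have h : compAt w.1 (diagOne ϖ * u * (diagOne ϖ)⁻¹) * compAt w.1 (diagOne ϖ) =
        compAt w.1 (diagOne ϖ) * compAt w.1 u := by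
        rw [← map_mul, inv_mul_cancel_right, map_mul]
      rw [← hly, ← hku] at h
      have h := congrArg Units.val h
      rw [Units.val_mul, Units.val_mul, hc w] at h
      change (inclAt w.1).mapMatrix l.1 * _ = _ * (inclAt w.1).mapMatrix k.1 at h
      rw [← map_mul, ← map_mul] at h
      exact Matrix.map_injective Subtype.val_injective h
    have hp0' : (p : w.1.adicCompletionIntegers F) ≠ 0 := fun h => hp0 w (by
      simpa using congrArg Subtype.val h)
    have h00 := congrFun (congrFun hmat 0) 0
    have h10 := congrFun (congrFun hmat 1) 0
    have h11 := congrFun (congrFun hmat 1) 1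
    simp [Matrix.mul_apply, Fin.sum_univ_two] at h00 h10 h11
    refine mul_inv_mem_localGamma hk h00 h10 ?_
    exact mul_left_cancel₀ hp0' (by rw [← h11, mul_comm])
  · intro k hk
    choose l _ hl using fun w : PlaceAbove F p =>
      exists_comp_of_mem_globalize (S.le_U0_top hk) w.1
    -- The cosets that come from `U` are separated from those killed by `ρ_κ` by the upper left
    -- entry of `k`. A single bad prime `w ∣ p` suffices for the vanishing.
    by_cases hunit : ∀ w, IsUnit (l w 0 0)
    · choose M b hb using fun w => exists_mul_diag_unipotent (l w) (hunit w)
        (p : w.1.adicCompletionIntegers F)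
      refine Or.inl (V.exists_mem_of_comp hk (fun w => unipotent (b w))
        (fun w => unipotent_mem_localGamma _ _) fun w => ⟨M w, Units.ext ?_⟩)
      rw [← hl w, Units.val_mul, Units.val_mul, Units.val_mul, hc w]
      change (inclAt w.1).mapMatrix (M w).1 * (_ * (inclAt w.1).mapMatrix (unipotent (b w)).1) =
        _ * (inclAt w.1).mapMatrix (l w).1
      rw [← map_mul, ← map_mul, ← map_mul, hb w]
    · right
      intro a ha μ
      push Not at hunit
      obtain ⟨w, hw⟩ := hunit
      have ha' := S.le_U0_top ha
      have hk' := S.le_U0_top hk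
      have hpms : pMat p (diagOne ϖ * k) = !![1, 0; 0, (p : Rp F p)] * pMat p k := by
        rw [pMat_mul p hxΔ (U0_le_Delta0 _ _ hk'), hpm]
      -- The first column of `(1, 0; 0, p) k` is formed by the upper left entry of `k`, a non-unit
      -- at `w`, and by `p` times the lower left one.
      have hcol0 : pMat p (diagOne ϖ * k) 0 0 w ∈
          IsLocalRing.maximalIdeal (w.1.adicCompletionIntegers F) := by
        rw [hpms]
        simp only [Matrix.mul_apply, Fin.sum_univ_two, Pi.add_apply, Pi.mul_apply]
        simpa [pMat_eq_of_comp (hl w)] using hw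
      have hcol1 : pMat p (diagOne ϖ * k) 1 0 w ∈
          IsLocalRing.maximalIdeal (w.1.adicCompletionIntegers F) := by
        have hp : (p : w.1.adicCompletionIntegers F) ∈
          IsLocalRing.maximalIdeal (w.1.adicCompletionIntegers F) := not_isUnit_natCast w
        rw [hpms]
        simp only [Matrix.mul_apply, Fin.sum_univ_two, Pi.add_apply, Pi.mul_apply]
        refine Ideal.add_mem _ ?_ (Ideal.mul_mem_right _ _ hp)
        simp
      -- Left multiplication by the integral matrix `a` only forms integral combinations of the two
      -- entries of this column, so it stays in the maximal ideal.
      have hcol : ∀ i, pMat p (a * diagOne ϖ * k) i 0 w ∈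
          IsLocalRing.maximalIdeal (w.1.adicCompletionIntegers F) := fun i => by
        rw [mul_assoc, pMat_mul p (U0_le_Delta0 _ _ ha') (mul_mem hxΔ (U0_le_Delta0 _ _ hk'))]
        simp only [Matrix.mul_apply, Fin.sum_univ_two, Pi.add_apply, Pi.mul_apply]
        exact Ideal.add_mem _ (Ideal.mul_mem_left _ _ hcol0) (Ideal.mul_mem_left _ _ hcol1)
      refine κ.rho_measAct_eq_zero ?_ (hcol 0) (hcol 1) μ
      rw [unitPart_mul_unit _ hk', unitPart_unit_mul _ ha', hux, mul_one]
      exact (isUnit_det_pMat p ha').mul (isUnit_det_pMat p hk')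

end ModularSymbols

end HilbertSymbols

theorem mainTheorem9 {F : Type*} [Field F] [NumberField F] [NumberField.IsTotallyReal F]
    {p : ℕ} [Fact p.Prime] (hp : p ≠ 2) (hunr : Squarefree (Ideal.span {(p : 𝓞 F)}))
    (S : TameLevel F p)
    {K : Type*} [NormedField K] [IsUltrametricDist K] [CharZero K] [NormedAlgebra ℚ_[p] K]
    [FiniteDimensional ℚ_[p] K] (hK : Nat.card (F →+* K) = Module.finrank ℚ F)
    (κ : ArithWeight S K) (V : κ.Level) (Φ : LambdaSymbols S K) :
    (∀ 𝔮 : HeightOneSpectrum (𝓞 F), (p : 𝓞 F) ∉ 𝔮.asIdeal →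
      ∀ (q : (FiniteAdeleRing (𝓞 F) F)ˣ) (hq : IsPrimeIdele 𝔮 q),
        V.rho (LambdaSymbols.T S K (diagOne q) (diagOne_mem hq.isIntegral _) Φ) =
          V.T (diagOne q) (diagOne_mem hq.isIntegral _) (V.rho Φ)) ∧
    (∀ (ϖ : (FiniteAdeleRing (𝓞 F) F)ˣ) (hϖ : IsPIdele p ϖ),
      V.rho (LambdaSymbols.T S K (diagOne ϖ) (diagOne_mem hϖ.isIntegral _) Φ) =
        V.T0 ϖ hϖ (V.rho Φ)) := by
  refine ⟨fun 𝔮 h𝔮 q hq => ?_, fun ϖ hϖ => rho_T_eq_T0 hunr V hϖ Φ⟩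
  -- A prime above `p` differs from `𝔮`, so the idele `q` is `1` there.
  exact rho_T_of_eq_one_above V hq.isIntegral
    (fun w => hq.2 w.1 fun h => h𝔮 (h ▸ w.2)) Φ
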